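/- **Setting.** All complexes $X$ are finite simplicial complexes, with $\emptyset$ as a face, and are pure of dimension $d$. $X(i)$ is the set of $i$-dimensional faces. The weight of a face is $w_X(\sigma)=\frac{|\{\tau\in X(d):\sigma\subseteq\tau\}|}{\binom{d+1}{|\sigma|}|X(d)|}$, and $\|S\|=\sum_{\sigma\in S}w_X(\sigma)$ for a set $S$ of faces. For a group $G$, a $0$-cochain is a function $h:X(0)\to G$, and a $1$-cochain is a function $f$ on oriented edges with $f(u,v)=f(v,u)^{-1}$. Put $d_0h(u,v)=h(u)h(v)^{-1}$ and $d_1f(u,v,w)=f(u,v)f(v,w)f(w,u)$. $B^0(X;G)$ is the set of constant $0$-cochains and $B^1(X;G)=\{d_0h\}$. The norm of a cochain is the norm of the set of faces where it is not $1$, and $\mathrm{dist}(f,g)=\|fg^{-1}\|$. $X$ is a *$\gamma$-coboundary expander over $G$* if for every face $\sigma$ (including $\emptyset$) with $\dim\sigma<d-2$ and $i=0,1$, every $i$-cochain $f$ of the link $X_\sigma$ satisfies $\|d_if\|\ge\gamma\,\mathrm{dist}(f,B^i(X_\sigma;G))$. A $k$-dimensional *assignment* gives each $\sigma\in X(k)$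 a function $\sigma\to\{0,1\}$; it is *agreeing* if all of these are restrictions of one function $X(0)\to\{0,1\}$. The distance of two assignments is the weight of the faces on which they differ. $X$ is a *$\beta$-$1$-up agreement expander* if for every $1\le i\le d-1$ and every $i$-dimensional assignment the following test rejects with probability at least $\frac{\beta}{i}$ times the distance of the assignment from the agreeing ones: sample an $(i+1)$-face by weight, then two distinct $i$-faces in it uniformly, and reject if their local functions differ on the intersection. A $k$-dimensional *$l$-assignment* $F$ gives each $\sigma\in X(k)$ functions $F^\sigma_1,\dots,F^\sigma_l:\sigma\to\{0,1\}$. It is *agreeing* ($F\in\mathcal A$) if there are $g_1,\dots,g_l:X(0)\to\{0,1\}$ and permutations $\pi_\sigma$ with $F^\sigma_{\pi_\sigma(i)}=g_i|_\sigma$ for all $\sigma,i$. It is *$2$-locally-differing* if for all $\sigma$ and $i\ne j$ the functions $F^\sigma_i,F^\sigma_j$ differ at two or more vertices. Put $\mathrm{dist}(F,H)=\sum_{\sigma\in X(k)}w_X(\sigma)\frac{|\{i:F_i^\sigma\neq H_i^\sigma\}|}{l}$. The *representation complex* $\hat R_k(X)$ has vertex set $X(k)$; for $i\ge1$ its $i$-faces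 are the sets of $i+1$ many $k$-faces of $X$ whose union is in $X(i+k)$ and whose intersection has $k$ elements. A *$(k-1)$-empty triangle* is a set $\{u,v,w\}$ of three pairwise adjacent vertices of $\hat R_k(X)$ with $\{u\cap v,v\cap w,w\cap u\}\in\hat R_{k-1}(X)(2)$. *Empty triangle test* $T$ of a $1$-cochain $f$ of $\hat R_k(X)$ over $G$: with probability $\frac12$ sample a triangle $\{u,v,w\}$ of $\hat R_k(X)$ by its weight, and with probability $\frac12$ sample a $(k-1)$-empty triangle $\{u,v,w\}$ with probability $w_{\hat R_{k-1}(X)}(\{u\cap v,v\cap w,w\cap u\})$; query $f(u,v),f(v,w),f(w,u)$ and accept iff $f(u,v)f(v,w)f(w,u)=1$. *List agreement test* of a $k$-dimensional $l$-assignment $F$: with probability $\frac12$ run $T$ over $G=S_l$, answering each query $(\sigma_1,\sigma_2)$ as follows: query the lists of $\sigma_1$ and $\sigma_2$; if some $\pi\in S_l$ satisfies $F^{\sigma_1}_i=F^{\sigma_2}_{\pi(i)}$ on $\sigma_1\cap\sigma_2$ for all $i$, then answer $\pi^{-1}$ for such a $\pi$, otherwise answer $1$. With probability $\frac12$ sample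 an edge $\{\sigma_1,\sigma_2\}$ of $\hat R_k(X)$ by its weight, query both lists, and accept iff such a $\pi$ exists. One query reveals one local function $F^\sigma_i$; repeated queries are counted once. **Theorem (Main Theorem).** There is a function $C=C(k,\gamma)>0$ of $k\geq 1$ and $\gamma>0$ such that the following holds for all $k\ge1$, $l$, $\gamma>0$, $\beta$ and every pure complex $X$ of dimension $d\ge k+2$ which is a $\gamma$-coboundary expander over $S_l$ and a $\beta$-$1$-up agreement expander. 1. (The constant $C$ is one of coboundary testability.) For every $1$-cochain $f$ of $\hat R_k(X)$ over $S_l$, the empty triangle test makes exactly $3$ queries, never rejects a coboundary, and $$C\cdot\mathrm{dist}\bigl(f,B^1(\hat R_k(X);S_l)\bigr)\le\Pr[T\text{ rejects }f].$$ 2. For every $2$-locally-differing $k$-dimensional $l$-assignment $F$, the list agreement test makes at most $3l$ queries, accepts with probability $1$ if $F$ is agreeing, and $$\Pr[\text{the test rejects }F]\ \ge\ \frac{C}{2C+2}\cdot\frac{\beta}{k}\cdot\mathrm{dist}(F,\mathcal A).$$ -/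

import Mathlib

/-! ### Finite simplicial complexes and the weight of a face -/

/-- A finite simplicial complex: a finite, downward closed family of finite sets. The empty set is
a face (of dimension `-1`). -/
structure FinComplex (V : Type*) [DecidableEq V] where
  faces : Finset (Finset V)
  empty_mem : ∅ ∈ faces
  down_closed : ∀ s ∈ faces, ∀ t, t ⊆ s → t ∈ faces

namespace FinComplex

section Basic

variable {V : Type*} [DecidableEq V] (X : FinComplex V)

/-- `X(i)`: the faces of dimension `i`, i.e. with `i + 1` elements. -/
def dimFaces (i : ℕ) : Finset (Finset V) := X.faces.filter (fun s => s.card = i + 1)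

/-- The largest number of elements of a face; the dimension of `X` is `X.rank - 1`. -/
def rank : ℕ := X.faces.sup Finset.card

/-- The faces of maximal dimension. -/
def topFaces : Finset (Finset V) := X.faces.filter (fun s => s.card = X.rank)

/-- `X` is pure: every face lies in a face of maximal dimension. -/
def IsPure : Prop := ∀ s ∈ X.faces, ∃ t ∈ X.topFaces, s ⊆ t

/-- The weight of a face `s` of the `d`-dimensional complex `X` (`d + 1 = X.rank`):
`|{t ∈ X(d) : s ⊆ t}| / (binom (d + 1) |s| * |X(d)|)`. -/
noncomputable def weight (s : Finset V) : ℝ :=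
  ((X.topFaces.filter (fun t => s ⊆ t)).card : ℝ) /
    ((X.rank.choose s.card : ℝ) * (X.topFaces.card : ℝ))

/-- The norm of a set of faces: the sum of the weights. -/
noncomputable def norm (S : Finset (Finset V)) : ℝ := ∑ s ∈ S, X.weight s

/-- The link of a face `s`: all `t \ s` with `s ⊆ t ∈ X`. -/
def link (s : Finset V) (hs : s ∈ X.faces) : FinComplex V where
  faces := (X.faces.filter (fun t => s ⊆ t)).image (fun t => t \ s)
  empty_mem := Finset.mem_image.2 ⟨s, by simp [hs], by simp⟩
  down_closed := by
    intro a ha b hb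
    obtain ⟨t, ht, rfl⟩ := Finset.mem_image.1 ha
    obtain ⟨ht, hst⟩ := Finset.mem_filter.1 ht
    refine Finset.mem_image.2 ⟨b ∪ s, Finset.mem_filter.2 ⟨X.down_closed t ht _ ?_, ?_⟩, ?_⟩
    · exact Finset.union_subset (hb.trans Finset.sdiff_subset) hst
    · exact Finset.subset_union_right
    · rw [Finset.union_sdiff_right]
      refine Finset.sdiff_eq_self_of_disjoint ?_
      exact Finset.disjoint_of_subset_left hb Finset.sdiff_disjoint

theorem card_le_rank {s : Finset V} (hs : s ∈ X.faces) : s.card ≤ X.rank :=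
  Finset.le_sup (f := Finset.card) hs

theorem topFaces_nonempty : X.topFaces.Nonempty := by
  obtain ⟨t, ht, h⟩ := Finset.exists_mem_eq_sup X.faces ⟨∅, X.empty_mem⟩ Finset.card
  exact ⟨t, Finset.mem_filter.2 ⟨ht, h.symm⟩⟩

theorem weight_nonneg (s : Finset V) : 0 ≤ X.weight s := by
  unfold weight; positivity

/-- In every dimension the weights of the faces add up to one. -/
theorem sum_weight (i : ℕ) (h : i + 1 ≤ X.rank) : ∑ s ∈ X.dimFaces i, X.weight s = 1 := by
  have h1 : ∀ s ∈ X.dimFaces i, X.weight s =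
      ((X.topFaces.filter (fun t => s ⊆ t)).card : ℝ) /
        ((X.rank.choose (i + 1) : ℝ) * (X.topFaces.card : ℝ)) := by
    intro s hs
    rw [weight, (Finset.mem_filter.1 hs).2]
  rw [Finset.sum_congr rfl h1, ← Finset.sum_div]
  have h2 : ∑ s ∈ X.dimFaces i, (X.topFaces.filter (fun t => s ⊆ t)).card =
      X.topFaces.card * X.rank.choose (i + 1) := by
    have := Finset.sum_card_bipartiteAbove_eq_sum_card_bipartiteBelow
      (s := X.dimFaces i) (t := X.topFaces) (fun s t => s ⊆ t)
    unfold Finset.bipartiteAbove Finset.bipartiteBelow at this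
    rw [this, Finset.card_eq_sum_ones, Finset.sum_mul]
    refine Finset.sum_congr rfl fun t ht => ?_
    obtain ⟨ht1, ht2⟩ := Finset.mem_filter.1 ht
    rw [one_mul, ← ht2, ← Finset.card_powersetCard]
    congr 1
    ext s
    simp only [dimFaces, Finset.mem_filter, Finset.mem_powersetCard]
    constructor
    · rintro ⟨⟨_, h⟩, h'⟩; exact ⟨h', h⟩
    · rintro ⟨h', h⟩; exact ⟨⟨X.down_closed t ht1 s h', h⟩, h'⟩
  have h3 : ∑ s ∈ X.dimFaces i, ((X.topFaces.filter (fun t => s ⊆ t)).card : ℝ) =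
      (X.topFaces.card : ℝ) * (X.rank.choose (i + 1) : ℝ) := by exact_mod_cast h2
  have h4 : (0 : ℝ) < X.rank.choose (i + 1) := by exact_mod_cast Nat.choose_pos h
  have h5 : (0 : ℝ) < X.topFaces.card := by
    exact_mod_cast Finset.card_pos.2 X.topFaces_nonempty
  rw [h3, mul_comm]
  exact div_self (by positivity)

/-- A random face of dimension `i`, distributed according to the weight. -/
noncomputable def sampleFace (i : ℕ) (h : i + 1 ≤ X.rank) : PMF {s // s ∈ X.dimFaces i} :=
  PMF.ofFintype (fun s => ENNReal.ofReal (X.weight s.1)) (by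
    rw [← ENNReal.ofReal_sum_of_nonneg (fun s _ => X.weight_nonneg _),
      Finset.sum_coe_sort (X.dimFaces i) (fun s => X.weight s), X.sum_weight i h,
      ENNReal.ofReal_one])

end Basic

/-! ### Cochains with coefficients in a group and coboundary expansion

A cochain is represented by a function on all points (or all ordered pairs of points) of the
ambient type; only the values at vertices (edges) of the complex are ever used. -/

section Cochains

variable {V : Type*} [DecidableEq V] (X : FinComplex V) {G : Type*} [Group G]

/-- `f` is a `1`-cochain: `f(u,v) = f(v,u)⁻¹` on every edge. -/
def IsCochain (f : V → V → G) : Prop :=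
  ∀ u v, ({u, v} : Finset V) ∈ X.dimFaces 1 → f u v = (f v u)⁻¹

/-- `(d₀ h)(u,v) = h(u) h(v)⁻¹`. -/
def d0 (h : V → G) : V → V → G := fun u v => h u * (h v)⁻¹

open scoped Classical in
/-- The norm of a `0`-cochain: the weight of the vertices where it is not `1`. -/
noncomputable def norm0 (h : V → G) : ℝ :=
  X.norm ((X.dimFaces 0).filter (fun s => ∃ v, s = {v} ∧ h v ≠ 1))

open scoped Classical in
/-- The norm of a `1`-cochain: the weight of the edges where it is not `1`. -/
noncomputable def norm1 (f : V → V → G) : ℝ :=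
  X.norm ((X.dimFaces 1).filter (fun s => ∃ u v, s = {u, v} ∧ f u v ≠ 1))

open scoped Classical in
/-- The norm of `d₁ f`, where `(d₁ f)(u,v,w) = f(u,v) f(v,w) f(w,u)`: the weight of the triangles
where it is not `1` (for a `1`-cochain this does not depend on the orientation). -/
noncomputable def normd1 (f : V → V → G) : ℝ :=
  X.norm ((X.dimFaces 2).filter (fun s => ∃ u v w, s = {u, v, w} ∧ f u v * f v w * f w u ≠ 1))

/-- `f` is a `1`-coboundary: `f = d₀ h` on every edge, for some `h`. -/
def IsCoboundary (f : V → V → G) : Prop :=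
  ∃ h : V → G, ∀ u v, ({u, v} : Finset V) ∈ X.dimFaces 1 → f u v = d0 h u v

/-- The distance of a `0`-cochain from the `0`-coboundaries, which are the constants. -/
noncomputable def distB0 (h : V → G) : ℝ := ⨅ g : G, X.norm0 (fun v => h v * g⁻¹)

/-- The distance of a `1`-cochain from the `1`-coboundaries `d₀ h`. -/
noncomputable def distB1 (f : V → V → G) : ℝ :=
  ⨅ h : V → G, X.norm1 (fun u v => f u v * (d0 h u v)⁻¹)

/-- `h₀(X;G) ≥ ε`. -/
def Expands0 (G : Type*) [Group G] (ε : ℝ) : Prop :=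
  ∀ h : V → G, ε * X.distB0 h ≤ X.norm1 (d0 h)

/-- `h₁(X;G) ≥ ε`. -/
def Expands1 (G : Type*) [Group G] (ε : ℝ) : Prop :=
  ∀ f : V → V → G, X.IsCochain f → ε * X.distB1 f ≤ X.normd1 f

/-- `X` is an `ε`-coboundary expander with coefficients in `G`: for every face `s` with
`dim s < dim X - 2` (including `s = ∅`, whose link is `X`) both `h₀` and `h₁` of the link of `s`
are at least `ε`. -/
def IsCoboundaryExpander (G : Type*) [Group G] (ε : ℝ) : Prop :=
  ∀ (s : Finset V) (hs : s ∈ X.faces), s.card + 3 ≤ X.rank →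
    (X.link s hs).Expands0 G ε ∧ (X.link s hs).Expands1 G ε

end Cochains

/-! ### Assignments, list assignments and agreement expansion -/

section Assignments

variable {V : Type*} [DecidableEq V] (X : FinComplex V)

/-- An assignment to the `k`-faces: a function `s → {0,1}` for every `k`-face `s`. -/
abbrev Assignment (k : ℕ) : Type _ :=
  (s : {s // s ∈ X.dimFaces k}) → ({v // v ∈ s.1} → Bool)

/-- A `k`-dimensional `l`-assignment: `l` functions `s → {0,1}` for every `k`-face `s`. -/
abbrev LAssignment (k l : ℕ) : Type _ :=
  (s : {s // s ∈ X.dimFaces k}) → Fin l → ({v // v ∈ s.1} → Bool)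

variable {X} {k l : ℕ}

/-- `a` consists of the restrictions of the global function `g`. -/
def Assignment.AgreesWith (a : X.Assignment k) (g : V → Bool) : Prop :=
  ∀ s, ∀ v : {v // v ∈ s.1}, a s v = g v.1

/-- `a` consists of the restrictions of one global function. -/
def Assignment.IsAgreeing (a : X.Assignment k) : Prop := ∃ g : V → Bool, a.AgreesWith g

open scoped Classical in
/-- The distance of two assignments: the weight of the faces where they differ. -/
noncomputable def Assignment.dist (a b : X.Assignment k) : ℝ :=
  ∑ s : {s // s ∈ X.dimFaces k}, if a s ≠ b s then X.weight s.1 else 0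

/-- The distance of an assignment from the agreeing assignments. -/
noncomputable def Assignment.distAgreeing (a : X.Assignment k) : ℝ :=
  ⨅ b : {b : X.Assignment k // b.IsAgreeing}, a.dist b.1

/-- The two local functions differ somewhere on the intersection of the two faces. -/
def Assignment.Disagree (a : X.Assignment k) (s t : {s // s ∈ X.dimFaces k}) : Prop :=
  ∃ v, ∃ (hs : v ∈ s.1) (ht : v ∈ t.1), a s ⟨v, hs⟩ ≠ a t ⟨v, ht⟩

open scoped Classical in
/-- The rejection probability of the `1`-up agreement test: sample a `(k+1)`-face `r` according to
the weight, then two of its `k`-subfaces uniformly, and reject if the local functions disagree. -/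
noncomputable def Assignment.upRejectProb (a : X.Assignment k) : ℝ :=
  ∑ r ∈ X.dimFaces (k + 1), X.weight r *
    ((((r.powersetCard (k + 1)).powersetCard 2).filter
        (fun e => ∃ s t : {s // s ∈ X.dimFaces k}, e = {s.1, t.1} ∧ a.Disagree s t)).card /
      ((r.powersetCard (k + 1)).powersetCard 2).card)

variable (X) in
/-- `X` is a `β`-agreement expander for the `1`-up distribution: in every dimension `i ≥ 1` in which
the test is defined (`i + 1 ≤ dim X`) the test rejects every assignment with probability at least
`β (1 - (i - 1) / i)` times its distance from agreeing; here `i - 1` is the dimension of the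
intersection of the two sampled faces. -/
def IsUpAgreementExpander (β : ℝ) : Prop :=
  ∀ i : ℕ, 1 ≤ i → i + 2 ≤ X.rank → ∀ a : X.Assignment i,
    β * (1 - ((i : ℝ) - 1) / i) * a.distAgreeing ≤ a.upRejectProb

/-- There are `l` global functions and, for every face, a permutation which identifies the list of
the face with the list of the restrictions of the global functions. -/
def LAssignment.IsAgreeing (F : X.LAssignment k l) : Prop :=
  ∃ g : Fin l → V → Bool, ∃ π : {s // s ∈ X.dimFaces k} → Equiv.Perm (Fin l),
    ∀ i, Assignment.AgreesWith (X := X) (k := k) (fun s => F s (π s i)) (g i)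

/-- The distance of two `l`-assignments. -/
noncomputable def LAssignment.dist (F H : X.LAssignment k l) : ℝ :=
  ∑ s : {s // s ∈ X.dimFaces k},
    X.weight s.1 * (((Finset.univ.filter (fun i => F s i ≠ H s i)).card : ℝ) / l)

/-- The distance of an `l`-assignment from the agreeing `l`-assignments. -/
noncomputable def LAssignment.distAgreeing (F : X.LAssignment k l) : ℝ :=
  ⨅ H : {H : X.LAssignment k l // H.IsAgreeing}, F.dist H.1

/-- On every face, any two functions of the list differ at two different vertices at least. -/
def LAssignment.TwoLocallyDiffering (F : X.LAssignment k l) : Prop :=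
  ∀ i j, i ≠ j → ∀ s, ∃ x y : {v // v ∈ s.1}, x ≠ y ∧ F s i x ≠ F s j x ∧ F s i y ≠ F s j y

end Assignments

/-! ### The representation complex -/

section Representation

variable {V : Type*} [DecidableEq V]

/-- The union of a family of sets. -/
def repUnion (s : Finset (Finset V)) : Finset V := s.biUnion id

/-- The core of a family of sets: the intersection of all members (empty for the empty family). -/
def core (s : Finset (Finset V)) : Finset V := (repUnion s).filter (fun v => ∀ t ∈ s, v ∈ t)

theorem core_subset {s : Finset (Finset V)} {a : Finset V} (ha : a ∈ s) : core s ⊆ a :=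
  fun _ hv => (Finset.mem_filter.1 hv).2 a ha

theorem inter_eq_core {s : Finset (Finset V)} {k : ℕ} (hs : ∀ a ∈ s, a.card = k + 1)
    (hc : k ≤ (core s).card) {a b : Finset V} (ha : a ∈ s) (hb : b ∈ s) (hab : a ≠ b) :
    a ∩ b = core s := by
  symm
  refine Finset.eq_of_subset_of_card_le
    (Finset.subset_inter (core_subset ha) (core_subset hb)) (le_trans ?_ hc)
  by_contra hlt
  have h1 : a ∩ b = a := Finset.eq_of_subset_of_card_le Finset.inter_subset_left
    (by rw [hs a ha]; omega)
  have h2 : a ∩ b = b := Finset.eq_of_subset_of_card_le Finset.inter_subset_right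
    (by rw [hs b hb]; omega)
  exact hab (h1.symm.trans h2)

theorem card_repUnion {s : Finset (Finset V)} {k : ℕ} (hs : ∀ a ∈ s, a.card = k + 1)
    (hc : (core s).card = k) : (repUnion s).card = s.card + k := by
  have hcs : core s ⊆ repUnion s := Finset.filter_subset _ _
  have h1 : repUnion s \ core s = s.biUnion (fun a => a \ core s) := by
    ext v
    simp only [repUnion, Finset.mem_sdiff, Finset.mem_biUnion, id]
    constructor
    · rintro ⟨⟨a, ha, hv⟩, hn⟩; exact ⟨a, ha, hv, hn⟩
    · rintro ⟨a, ha, hv, hn⟩; exact ⟨⟨a, ha, hv⟩, hn⟩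
  have h2 : (repUnion s \ core s).card = s.card := by
    rw [h1, Finset.card_biUnion, Finset.card_eq_sum_ones]
    · refine Finset.sum_congr rfl fun a ha => ?_
      rw [Finset.card_sdiff_of_subset (core_subset ha), hs a ha, hc]; omega
    · intro a ha b hb hab
      refine Finset.disjoint_left.2 fun v hva hvb => ?_
      simp only [Finset.mem_sdiff] at hva hvb
      exact hva.2 (inter_eq_core hs hc.ge ha hb hab ▸ Finset.mem_inter.2 ⟨hva.1, hvb.1⟩)
  have h3 := Finset.card_sdiff_add_card_eq_card hcs
  omega

variable (X : FinComplex V)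

/-- The representation complex of the `k`-faces of `X`. Its vertices are the `k`-faces of `X`; for
`i ≥ 1` its `i`-faces are the sets of `i + 1` many `k`-faces whose union is an `(i+k)`-face of `X`
and whose intersection has `k` elements. -/
def rep (k : ℕ) : FinComplex (Finset V) where
  faces := (X.dimFaces k).powerset.filter (fun s => s.card ≤ 1 ∨
    (repUnion s ∈ X.faces ∧ (repUnion s).card = s.card + k ∧ (core s).card = k))
  empty_mem := by simp
  down_closed := by
    intro s hs t hts
    obtain ⟨hs1, hs2⟩ := Finset.mem_filter.1 hs
    have hs1 := Finset.mem_powerset.1 hs1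
    refine Finset.mem_filter.2 ⟨Finset.mem_powerset.2 (hts.trans hs1), ?_⟩
    by_cases htc : t.card ≤ 1
    · exact Or.inl htc
    right
    have hle := Finset.card_le_card hts
    obtain ⟨h1, h2, h3⟩ := hs2.resolve_left (by omega)
    have hcard : ∀ a ∈ s, a.card = k + 1 := fun a ha => (Finset.mem_filter.1 (hs1 ha)).2
    obtain ⟨a, ha, b, hb, hab⟩ := Finset.one_lt_card.1 (not_le.1 htc)
    have hsub : core s ⊆ core t := by
      intro v hv
      refine Finset.mem_filter.2
        ⟨Finset.mem_biUnion.2 ⟨a, ha, core_subset (hts ha) hv⟩, fun c hc => ?_⟩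
      exact core_subset (hts hc) hv
    have hk : (core t).card = k := by
      refine le_antisymm ?_ (h3 ▸ Finset.card_le_card hsub)
      have h4 : core t ⊆ a ∩ b := Finset.subset_inter (core_subset ha) (core_subset hb)
      rw [inter_eq_core hcard h3.ge (hts ha) (hts hb) hab] at h4
      exact h3 ▸ Finset.card_le_card h4
    exact ⟨X.down_closed _ h1 _ (Finset.biUnion_subset_biUnion_of_subset_left _ hts),
      card_repUnion (fun c hc => hcard c (hts hc)) hk, hk⟩

variable {X}

theorem mem_rep_dimFaces {k i : ℕ} {s : Finset (Finset V)} :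
    s ∈ (X.rep k).dimFaces (i + 1) ↔ s ⊆ X.dimFaces k ∧ s.card = i + 2 ∧
      repUnion s ∈ X.faces ∧ (repUnion s).card = s.card + k ∧ (core s).card = k := by
  simp only [dimFaces, rep, Finset.mem_filter, Finset.mem_powerset]
  constructor
  · rintro ⟨⟨h1, h2⟩, h3⟩
    exact ⟨h1, h3, h2.resolve_left (by omega)⟩
  · rintro ⟨h1, h2, h3⟩
    exact ⟨⟨h1, Or.inr h3⟩, h2⟩

theorem mem_dimFaces_of_mem_rep {k i : ℕ} {s : Finset (Finset V)}
    (hs : s ∈ (X.rep k).dimFaces i) {a : Finset V} (ha : a ∈ s) : a ∈ X.dimFaces k :=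
  Finset.mem_powerset.1 (Finset.mem_filter.1 (Finset.mem_filter.1 hs).1).1 ha

variable (X) in
theorem le_rank_rep (k i : ℕ) (h : k + (i + 2) ≤ X.rank) : i + 2 ≤ (X.rep k).rank := by
  obtain ⟨τ, hτ⟩ := X.topFaces_nonempty
  obtain ⟨hτ1, hτ2⟩ := Finset.mem_filter.1 hτ
  obtain ⟨σ, hσ, hσc⟩ := Finset.exists_subset_card_eq (s := τ) (n := k + (i + 2)) (by omega)
  obtain ⟨c, hc, hcc⟩ := Finset.exists_subset_card_eq (s := σ) (n := k) (by omega)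
  have hσX : σ ∈ X.faces := X.down_closed _ hτ1 _ hσ
  set s : Finset (Finset V) := (σ \ c).image (fun v => insert v c) with hs
  have hdc : (σ \ c).card = i + 2 := by
    rw [Finset.card_sdiff_of_subset hc]; omega
  have hinj : Set.InjOn (fun v => insert v c) ((σ \ c : Finset V) : Set V) := by
    intro v hv w hw hvw
    have h1 : v ∈ insert w c := by
      have : v ∈ insert v c := Finset.mem_insert_self _ _
      exact (show insert v c = insert w c from hvw) ▸ this
    rcases Finset.mem_insert.1 h1 with h | h
    · exact h
    · exact absurd h (Finset.mem_sdiff.1 (Finset.mem_coe.1 hv)).2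
  have hsc : s.card = i + 2 := by rw [hs, Finset.card_image_of_injOn hinj, hdc]
  have hmem : ∀ a ∈ s, a ⊆ σ ∧ a.card = k + 1 ∧ c ⊆ a := by
    intro a ha
    obtain ⟨v, hv, rfl⟩ := Finset.mem_image.1 ha
    obtain ⟨hv1, hv2⟩ := Finset.mem_sdiff.1 hv
    refine ⟨Finset.insert_subset hv1 hc, ?_, Finset.subset_insert _ _⟩
    rw [Finset.card_insert_of_notMem hv2, hcc]
  obtain ⟨a, ha, b, hb, hab⟩ := Finset.one_lt_card.1 (show 1 < s.card by omega)
  have hcs : c ⊆ core s := fun v hv => Finset.mem_filter.2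
    ⟨Finset.mem_biUnion.2 ⟨a, ha, (hmem a ha).2.2 hv⟩, fun d hd => (hmem d hd).2.2 hv⟩
  have hck : (core s).card = k := by
    refine le_antisymm ?_ (hcc ▸ Finset.card_le_card hcs)
    by_contra hlt
    have h1 : core s = a := Finset.eq_of_subset_of_card_le (core_subset ha)
      (by rw [(hmem a ha).2.1]; omega)
    have h2 : core s = b := Finset.eq_of_subset_of_card_le (core_subset hb)
      (by rw [(hmem b hb).2.1]; omega)
    exact hab (h1.symm.trans h2)
  have hR : repUnion s ⊆ σ := Finset.biUnion_subset.2 fun d hd => (hmem d hd).1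
  have hmemrep : s ∈ (X.rep k).dimFaces (i + 1) := by
    refine mem_rep_dimFaces.2 ⟨fun d hd => ?_, hsc, X.down_closed _ hσX _ hR,
      card_repUnion (fun d hd => (hmem d hd).2.1) hck, hck⟩
    exact Finset.mem_filter.2 ⟨X.down_closed _ hσX _ (hmem d hd).1, (hmem d hd).2.1⟩
  rw [← hsc]
  exact card_le_rank _ (Finset.mem_filter.1 hmemrep).1

/-! ### Empty triangles -/

/-- The set of the pairwise intersections of the members of `t`. -/
def pairInter (t : Finset (Finset V)) : Finset (Finset V) := t.offDiag.image (fun p => p.1 ∩ p.2)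

/-- The set of the pairwise unions of the members of `t`. -/
def pairUnion (t : Finset (Finset V)) : Finset (Finset V) := t.offDiag.image (fun p => p.1 ∪ p.2)

variable (X)

/-- The `(k-1)`-empty triangles of the representation complex of the `k`-faces: sets of three
vertices `u, v, w`, any two of them joined by an edge, such that
`{u ∩ v, v ∩ w, w ∩ u}` is a triangle of the representation complex of the `(k-1)`-faces. -/
def emptyTriangles (k : ℕ) : Finset (Finset (Finset V)) :=
  ((X.dimFaces k).powersetCard 3).filter (fun t =>
    (∀ u ∈ t, ∀ v ∈ t, u ≠ v → ({u, v} : Finset (Finset V)) ∈ (X.rep k).dimFaces 1) ∧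
      pairInter t ∈ (X.rep (k - 1)).dimFaces 2)

variable {X}

theorem offDiag_image_triple {W : Type*} [DecidableEq W] {t : Finset (Finset V)}
    {u v w : Finset V} (ht : t = {u, v, w}) (huv : u ≠ v) (huw : u ≠ w) (hvw : v ≠ w)
    (op : Finset V → Finset V → W) (hop : ∀ a b, op a b = op b a) :
    t.offDiag.image (fun p => op p.1 p.2) = {op u v, op v w, op w u} := by
  subst ht
  ext x
  simp only [Finset.mem_image, Finset.mem_offDiag, Finset.mem_insert, Finset.mem_singleton,
    Prod.exists]
  constructor
  · rintro ⟨a, b, ⟨ha, hb, hab⟩, rfl⟩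
    rcases ha with rfl | rfl | rfl <;> rcases hb with rfl | rfl | rfl <;> grind
  · rintro (rfl | rfl | rfl)
    · exact ⟨u, v, by simp [huv], rfl⟩
    · exact ⟨v, w, by simp [hvw], rfl⟩
    · exact ⟨w, u, by simp [huw.symm], rfl⟩

theorem pairInter_triple {t : Finset (Finset V)} {u v w : Finset V} (ht : t = {u, v, w})
    (huv : u ≠ v) (huw : u ≠ w) (hvw : v ≠ w) : pairInter t = {u ∩ v, v ∩ w, w ∩ u} :=
  offDiag_image_triple ht huv huw hvw (fun a b => a ∩ b) (fun a b => Finset.inter_comm a b)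

theorem pairUnion_triple {t : Finset (Finset V)} {u v w : Finset V} (ht : t = {u, v, w})
    (huv : u ≠ v) (huw : u ≠ w) (hvw : v ≠ w) : pairUnion t = {u ∪ v, v ∪ w, w ∪ u} :=
  offDiag_image_triple ht huv huw hvw (fun a b => a ∪ b) (fun a b => Finset.union_comm a b)

theorem ne_of_card_triple {W : Type*} [DecidableEq W] {a b c : W}
    (h : ({a, b, c} : Finset W).card = 3) : a ≠ b ∧ a ≠ c ∧ b ≠ c := by
  refine ⟨?_, ?_, ?_⟩ <;> rintro rfl
  · have := Finset.card_le_two (a := a) (b := c)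
    simp at h; omega
  · have := Finset.card_le_two (a := a) (b := b)
    rw [Finset.insert_eq_of_mem (by simp)] at h
    have := Finset.card_le_two (a := b) (b := a)
    omega
  · have := Finset.card_le_two (a := a) (b := b)
    simp at h; omega

theorem pairUnion_pairInter {k : ℕ} (hk : 1 ≤ k) {t : Finset (Finset V)}
    (ht : t ∈ X.emptyTriangles k) : pairUnion (pairInter t) = t := by
  obtain ⟨ht1, ht2, ht3⟩ := Finset.mem_filter.1 ht
  obtain ⟨hsub, hc⟩ := Finset.mem_powersetCard.1 ht1
  obtain ⟨u, v, w, huv, huw, hvw, rfl⟩ := Finset.card_eq_three.1 hc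
  have hI := pairInter_triple rfl huv huw hvw
  rw [hI] at ht3 ⊢
  obtain ⟨hs, hc3, -⟩ := mem_rep_dimFaces.1 ht3
  obtain ⟨n1, n2, n3⟩ := ne_of_card_triple hc3
  rw [pairUnion_triple rfl n1 n2 n3]
  have key : ∀ a b p : Finset V, a ∈ ({u ∩ v, v ∩ w, w ∩ u} : Finset (Finset V)) →
      b ∈ ({u ∩ v, v ∩ w, w ∩ u} : Finset (Finset V)) → a ≠ b → a ⊆ p → b ⊆ p →
      p ∈ ({u, v, w} : Finset (Finset V)) → a ∪ b = p := by
    intro a b p ha hb hab hap hbp hp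
    have hca : a.card = k - 1 + 1 := (Finset.mem_filter.1 (hs ha)).2
    have hcb : b.card = k - 1 + 1 := (Finset.mem_filter.1 (hs hb)).2
    have hcp : p.card = k + 1 := (Finset.mem_filter.1 (hsub hp)).2
    refine Finset.eq_of_subset_of_card_le (Finset.union_subset hap hbp) ?_
    by_contra hlt
    have h1 : a = a ∪ b := Finset.eq_of_subset_of_card_le Finset.subset_union_left (by omega)
    have h2 : b = a ∪ b := Finset.eq_of_subset_of_card_le Finset.subset_union_right (by omega)
    exact hab (h1.trans h2.symm)
  have e1 : (u ∩ v) ∪ (v ∩ w) = v := key _ _ _ (by simp) (by simp) n1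
    Finset.inter_subset_right Finset.inter_subset_left (by simp)
  have e2 : (v ∩ w) ∪ (w ∩ u) = w := key _ _ _ (by simp) (by simp) n3
    Finset.inter_subset_right Finset.inter_subset_left (by simp)
  have e3 : (w ∩ u) ∪ (u ∩ v) = u := key _ _ _ (by simp) (by simp) n2.symm
    Finset.inter_subset_right Finset.inter_subset_left (by simp)
  rw [e1, e2, e3]
  ext x; simp; tauto

theorem union_triple (a b c : Finset V) :
    (b ∪ c ⊆ a ∪ b ∪ c ∧ c ∪ a ⊆ a ∪ b ∪ c) ∧ (a ∪ b) ∪ (b ∪ c) = a ∪ b ∪ c ∧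
      (b ∪ c) ∪ (c ∪ a) = a ∪ b ∪ c ∧ (c ∪ a) ∪ (a ∪ b) = a ∪ b ∪ c := by
  refine ⟨⟨?_, ?_⟩, ?_, ?_, ?_⟩
  · intro x; simp only [Finset.mem_union]; tauto
  · intro x; simp only [Finset.mem_union]; tauto
  all_goals ext x; simp only [Finset.mem_union]; tauto

theorem pairUnion_mem {k : ℕ} (hk : 1 ≤ k) {t : Finset (Finset V)}
    (ht : t ∈ (X.rep (k - 1)).dimFaces 2) :
    pairUnion t ∈ X.emptyTriangles k ∧ pairInter (pairUnion t) = t := by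
  obtain ⟨hs, hc, hR, hRc, hcore⟩ := mem_rep_dimFaces.1 ht
  have hcard : ∀ a ∈ t, a.card = (k - 1) + 1 := fun a ha => (Finset.mem_filter.1 (hs ha)).2
  have hint := fun a ha b hb hab =>
    inter_eq_core (k := k - 1) hcard hcore.ge (a := a) (b := b) ha hb hab
  obtain ⟨a, b, c, hab, hac, hbc, rfl⟩ := Finset.card_eq_three.1 hc
  have iab := hint a (by simp) b (by simp) hab
  have ibc := hint b (by simp) c (by simp) hbc
  have ica := hint c (by simp) a (by simp) hac.symm
  have ca := hcard a (by simp)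
  have cb := hcard b (by simp)
  have cc := hcard c (by simp)
  set K := core ({a, b, c} : Finset (Finset V)) with hK
  have hUn : repUnion ({a, b, c} : Finset (Finset V)) = a ∪ b ∪ c := by
    ext x; simp [repUnion]
  have hUc : (a ∪ b ∪ c).card = k + 2 := by rw [← hUn, hRc, hc]; omega
  have ucard : ∀ p q : Finset V, p ∩ q = K → p.card = (k - 1) + 1 → q.card = (k - 1) + 1 →
      (p ∪ q).card = k + 1 := by
    intro p q hpq hp hq
    have := Finset.card_union_add_card_inter p q
    rw [hpq, hcore] at this
    omega
  obtain ⟨⟨s2, s3⟩, w1, w2, w3⟩ := union_triple a b c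
  have uab := ucard a b iab ca cb
  have ubc := ucard b c ibc cb cc
  have uca := ucard c a ica cc ca
  -- intersections of the unions
  have tri : ∀ p q r : Finset V, r ∩ p = K → K ⊆ q → (p ∪ q) ∩ (q ∪ r) = q := by
    intro p q r hpr hKq
    ext x
    simp only [Finset.mem_inter, Finset.mem_union]
    constructor
    · rintro ⟨h1 | h1, h2 | h2⟩
      · exact h2
      · exact hKq (hpr ▸ Finset.mem_inter.2 ⟨h2, h1⟩)
      · exact h1
      · exact h1
    · exact fun h => ⟨Or.inr h, Or.inl h⟩
  have Ka : K ⊆ a := core_subset (by simp)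
  have Kb : K ⊆ b := core_subset (by simp)
  have Kc : K ⊆ c := core_subset (by simp)
  have e1 : (a ∪ b) ∩ (b ∪ c) = b := tri a b c ica Kb
  have e2 : (b ∪ c) ∩ (c ∪ a) = c := tri b c a iab Kc
  have e3 : (c ∪ a) ∩ (a ∪ b) = a := tri c a b ibc Ka
  have n1 : a ∪ b ≠ b ∪ c := by
    intro h; rw [h, Finset.inter_self] at e1; rw [e1] at ubc; omega
  have n2 : b ∪ c ≠ c ∪ a := by
    intro h; rw [h, Finset.inter_self] at e2; rw [e2] at uca; omega
  have n3 : c ∪ a ≠ a ∪ b := by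
    intro h; rw [h, Finset.inter_self] at e3; rw [e3] at uab; omega
  have hPU := pairUnion_triple rfl hab hac hbc
  have hPI : pairInter (pairUnion ({a, b, c} : Finset (Finset V))) = {a, b, c} := by
    rw [hPU, pairInter_triple rfl n1 n3.symm n2, e1, e2, e3]
    ext x; simp; tauto
  refine ⟨?_, hPI⟩
  refine Finset.mem_filter.2 ⟨?_, ?_, hPI.symm ▸ ht⟩
  · rw [hPU]
    refine Finset.mem_powersetCard.2 ⟨?_, Finset.card_eq_three.2 ⟨_, _, _, n1, n3.symm, n2, rfl⟩⟩
    intro p hp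
    have hX : ∀ q, q ⊆ a ∪ b ∪ c → q ∈ X.faces := fun q hq =>
      X.down_closed _ (hUn ▸ hR) q hq
    simp only [Finset.mem_insert, Finset.mem_singleton] at hp
    rcases hp with rfl | rfl | rfl
    · exact Finset.mem_filter.2 ⟨hX _ Finset.subset_union_left, uab⟩
    · exact Finset.mem_filter.2 ⟨hX _ s2, ubc⟩
    · exact Finset.mem_filter.2 ⟨hX _ s3, uca⟩
  · have edge : ∀ p q : Finset V, p ∈ X.dimFaces k → q ∈ X.dimFaces k → p ≠ q →
        p ∪ q = a ∪ b ∪ c → (p ∩ q).card = k →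
        ({p, q} : Finset (Finset V)) ∈ (X.rep k).dimFaces 1 := by
      intro p q hp hq hpq hU hI
      have hco : core ({p, q} : Finset (Finset V)) = p ∩ q := by
        ext x; simp [core, repUnion]; tauto
      have hre : repUnion ({p, q} : Finset (Finset V)) = a ∪ b ∪ c := by
        rw [← hU]; ext x; simp [repUnion]
      have hp2 : ({p, q} : Finset (Finset V)).card = 2 := Finset.card_pair hpq
      refine mem_rep_dimFaces.2 ⟨?_, hp2, ?_, ?_, ?_⟩
      · intro r hr
        simp only [Finset.mem_insert, Finset.mem_singleton] at hr
        rcases hr with rfl | rfl <;> assumption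
      · rw [hre, ← hUn]; exact hR
      · rw [hre, hUc, hp2]; omega
      · rw [hco, hI]
    have hX : ∀ q, q ⊆ a ∪ b ∪ c → q.card = k + 1 → q ∈ X.dimFaces k := fun q hq hqc =>
      Finset.mem_filter.2 ⟨X.down_closed _ (hUn ▸ hR) q hq, hqc⟩
    have m1 := hX (a ∪ b) Finset.subset_union_left uab
    have m2 := hX (b ∪ c) s2 ubc
    have m3 := hX (c ∪ a) s3 uca
    have E1 := edge _ _ m1 m2 n1 w1 (by rw [e1]; omega)
    have E2 := edge _ _ m2 m3 n2 w2 (by rw [e2]; omega)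
    have E3 := edge _ _ m3 m1 n3 w3 (by rw [e3]; omega)
    intro p hp q hq hpq
    rw [hPU] at hp hq
    simp only [Finset.mem_insert, Finset.mem_singleton] at hp hq
    rcases hp with rfl | rfl | rfl <;> rcases hq with rfl | rfl | rfl
    · exact absurd rfl hpq
    · exact E1
    · rw [Finset.pair_comm]; exact E3
    · rw [Finset.pair_comm]; exact E1
    · exact absurd rfl hpq
    · exact E2
    · exact E3
    · rw [Finset.pair_comm]; exact E2
    · exact absurd rfl hpq

theorem sum_emptyTriangles {k : ℕ} (hk : 1 ≤ k) (h : k + 2 ≤ X.rank) :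
    ∑ t ∈ X.emptyTriangles k, (X.rep (k - 1)).weight (pairInter t) = 1 := by
  rw [← (X.rep (k - 1)).sum_weight 2 (X.le_rank_rep (k - 1) 1 (by omega))]
  refine Finset.sum_bij' (fun t _ => pairInter t) (fun t _ => pairUnion t) ?_ ?_ ?_ ?_ ?_
  · exact fun t ht => (Finset.mem_filter.1 ht).2.2
  · exact fun t ht => (pairUnion_mem hk ht).1
  · exact fun t ht => pairUnion_pairInter hk ht
  · exact fun t ht => (pairUnion_mem hk ht).2
  · exact fun t ht => rfl

variable (X) in
/-- A random `(k-1)`-empty triangle, distributed according to the weight in the representation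
complex of the `(k-1)`-faces. -/
noncomputable def sampleEmptyTriangle (k : ℕ) (hk : 1 ≤ k) (h : k + 2 ≤ X.rank) :
    PMF {t // t ∈ X.emptyTriangles k} :=
  PMF.ofFintype (fun t => ENNReal.ofReal ((X.rep (k - 1)).weight (pairInter t.1))) (by
    rw [← ENNReal.ofReal_sum_of_nonneg (fun s _ => weight_nonneg _ _),
      Finset.sum_coe_sort (X.emptyTriangles k) (fun t => (X.rep (k - 1)).weight (pairInter t)),
      sum_emptyTriangles hk h, ENNReal.ofReal_one])

end Representation

end FinComplex

/-! ### Query algorithms -/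

/-- A deterministic adaptive query algorithm (decision tree): it asks questions `q : Q` whose
answers lie in `A q`, and finally outputs an element of `α`. -/
inductive QueryTree (Q : Type*) (A : Q → Type*) (α : Type*) where
  | leaf (a : α) : QueryTree Q A α
  | ask (q : Q) (next : A q → QueryTree Q A α) : QueryTree Q A α

namespace QueryTree

variable {Q : Type*} {A : Q → Type*} {α β : Type*}

/-- The output when the oracle `O` answers the questions. -/
def eval (O : (q : Q) → A q) : QueryTree Q A α → α
  | leaf a => a
  | ask q next => eval O (next (O q))

/-- The set of the (distinct) questions asked when the oracle `O` answers. -/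
def asked [DecidableEq Q] (O : (q : Q) → A q) : QueryTree Q A α → Finset Q
  | leaf _ => ∅
  | ask q next => insert q (asked O (next (O q)))

/-- Run one algorithm and continue depending on its output. -/
def bind (T : QueryTree Q A α) (f : α → QueryTree Q A β) : QueryTree Q A β :=
  match T with
  | leaf a => f a
  | ask q next => ask q (fun a => bind (next a) f)

/-- Answer every question of `T` by running the algorithm `S q`. -/
def simulate {Q' : Type*} {A' : Q' → Type*} (T : QueryTree Q A α)
    (S : (q : Q) → QueryTree Q' A' (A q)) : QueryTree Q' A' α :=
  match T with
  | leaf a => leaf a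
  | ask q next => bind (S q) (fun a => simulate (next a) S)

/-- Ask `n` given questions one after the other and return all the answers. -/
def askAll : {n : ℕ} → (q : Fin n → Q) → QueryTree Q A ((i : Fin n) → A (q i))
  | 0, _ => leaf (fun i => i.elim0)
  | _ + 1, q => ask (q 0) fun a =>
      bind (askAll (fun i => q i.succ)) fun r => leaf (Fin.cons a r)

end QueryTree

/-- A randomized query algorithm with output accept (`true`) or reject (`false`): a random decision
tree. -/
abbrev Tester (Q : Type*) (A : Q → Type*) : Type _ := PMF (QueryTree Q A Bool)

/-- The probability that the tester rejects when the oracle is `O`. -/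
noncomputable def Tester.rejectProb {Q : Type*} {A : Q → Type*} (T : Tester Q A)
    (O : (q : Q) → A q) : ℝ :=
  ((PMF.map (fun t => t.eval O) T) false).toReal

/-- With probability `1/2` run the first tester and with probability `1/2` the second. -/
noncomputable def Tester.mix {Q : Type*} {A : Q → Type*} (S T : Tester Q A) : Tester Q A :=
  PMF.bind (PMF.uniformOfFintype Bool) (fun b => if b then S else T)

namespace FinComplex

variable {V : Type*} [DecidableEq V]

/-! ### The empty triangle test -/

/-- The questions to a `1`-cochain: the oriented edges of the complex. -/
abbrev EdgeQuery (Y : FinComplex V) : Type _ :=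
  {e : V × V // ({e.1, e.2} : Finset V) ∈ Y.dimFaces 1}

/-- The oracle which answers the question `(u,v)` by `f(u,v)`. -/
def edgeOracle (Y : FinComplex V) {G : Type*} (f : V → V → G) : (e : Y.EdgeQuery) → G :=
  fun e => f e.1.1 e.1.2

/-- For a set `t = {u,v,w}` of three vertices any two of which form an edge (with some fixed
orientation), query `f(u,v), f(v,w), f(w,u)` and accept iff `f(u,v) f(v,w) f(w,u) = 1`. -/
noncomputable def triangleTree (Y : FinComplex V) (G : Type*) [Group G] [DecidableEq G]
    (t : Finset V) (ht : t.card = 3)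
    (he : ∀ u ∈ t, ∀ v ∈ t, u ≠ v → ({u, v} : Finset V) ∈ Y.dimFaces 1) :
    QueryTree Y.EdgeQuery (fun _ => G) Bool :=
  have h : ∃ p : V × V × V, p.1 ≠ p.2.1 ∧ p.1 ≠ p.2.2 ∧ p.2.1 ≠ p.2.2 ∧
      t = {p.1, p.2.1, p.2.2} := by
    obtain ⟨u, v, w, h⟩ := Finset.card_eq_three.1 ht
    exact ⟨(u, v, w), h⟩
  let u := h.choose.1
  let v := h.choose.2.1
  let w := h.choose.2.2
  have hs := h.choose_spec
  have hu : u ∈ t := by rw [hs.2.2.2]; simp [u]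
  have hv : v ∈ t := by rw [hs.2.2.2]; simp [v]
  have hw : w ∈ t := by rw [hs.2.2.2]; simp [w]
  .ask ⟨(u, v), he u hu v hv hs.1⟩ fun a =>
  .ask ⟨(v, w), he v hv w hw hs.2.2.1⟩ fun b =>
  .ask ⟨(w, u), he w hw u hu hs.2.1.symm⟩ fun c =>
  .leaf (decide (a * b * c = 1))

theorem card_of_mem_dimFaces {Y : FinComplex V} {i : ℕ} {t : Finset V} (ht : t ∈ Y.dimFaces i) :
    t.card = i + 1 :=
  (Finset.mem_filter.1 ht).2

theorem pair_mem_of_mem_dimFaces {Y : FinComplex V} {t : Finset V} (ht : t ∈ Y.dimFaces 2) :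
    ∀ u ∈ t, ∀ v ∈ t, u ≠ v → ({u, v} : Finset V) ∈ Y.dimFaces 1 := by
  intro u hu v hv huv
  refine Finset.mem_filter.2 ⟨Y.down_closed t (Finset.mem_filter.1 ht).1 _ ?_,
    Finset.card_pair huv⟩
  intro x hx
  simp only [Finset.mem_insert, Finset.mem_singleton] at hx
  rcases hx with rfl | rfl <;> assumption

/-- The empty triangle test for `1`-cochains of the representation complex of the `k`-faces: with
probability `1/2` check a random triangle of the representation complex, and with probability `1/2`
check a random `(k-1)`-empty triangle. -/
noncomputable def emptyTriangleTest (X : FinComplex V) (G : Type*) [Group G] [DecidableEq G]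
    (k : ℕ) (hk : 1 ≤ k) (h : k + 3 ≤ X.rank) :
    Tester (X.rep k).EdgeQuery (fun _ => G) :=
  Tester.mix
    (PMF.map (fun t => triangleTree (X.rep k) G t.1 (card_of_mem_dimFaces t.2)
      (pair_mem_of_mem_dimFaces t.2))
      ((X.rep k).sampleFace 2 (X.le_rank_rep k 1 h)))
    (PMF.map (fun t => triangleTree (X.rep k) G t.1
      (Finset.mem_powersetCard.1 (Finset.mem_filter.1 t.2).1).2 (Finset.mem_filter.1 t.2).2.1)
      (X.sampleEmptyTriangle k hk (by omega)))

/-! ### The test for list agreement -/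

/-- The questions to an `l`-assignment: a `k`-face `s` and an index `i`; the answer is `F^s_i`. -/
abbrev ListQuery (X : FinComplex V) (k l : ℕ) : Type _ := {s // s ∈ X.dimFaces k} × Fin l

/-- The type of the answer to a question: the functions `s → {0,1}`. -/
abbrev ListAnswer (X : FinComplex V) (k l : ℕ) (q : X.ListQuery k l) : Type _ :=
  {v // v ∈ q.1.1} → Bool

/-- The oracle which answers the question `(s,i)` by `F^s_i`. -/
def LAssignment.oracle {X : FinComplex V} {k l : ℕ} (F : X.LAssignment k l) :
    (q : X.ListQuery k l) → X.ListAnswer k l q :=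
  fun q => F q.1 q.2

section ListTest

variable (X : FinComplex V) (k l : ℕ)

/-- Query the whole list of a face. -/
def queryList (s : {s // s ∈ X.dimFaces k}) :
    QueryTree (X.ListQuery k l) (X.ListAnswer k l) (Fin l → ({v // v ∈ s.1} → Bool)) :=
  QueryTree.askAll (fun i : Fin l => ((s, i) : X.ListQuery k l))

variable {l}

/-- `a_i = b_{π(i)}` on the intersection of `s` and `t`, for every `i`. -/
def Matches {s t : Finset V} (a : Fin l → ({v // v ∈ s} → Bool))
    (b : Fin l → ({v // v ∈ t} → Bool)) (π : Equiv.Perm (Fin l)) : Prop :=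
  ∀ i v, ∀ (hs : v ∈ s) (ht : v ∈ t), a i ⟨v, hs⟩ = b (π i) ⟨v, ht⟩

open scoped Classical in
/-- The permutation by which the near cover matches the two lists: some `π` with `a_i = b_{π(i)}` on
the intersection if there is one, and the identity otherwise. -/
noncomputable def coverPerm {s t : Finset V} (a : Fin l → ({v // v ∈ s} → Bool))
    (b : Fin l → ({v // v ∈ t} → Bool)) : Equiv.Perm (Fin l) :=
  if h : ∃ π, Matches a b π then h.choose else 1

variable (l)

/-- Query cover edge: query both lists and return the value at `(s,t)` of the cochain which
describes the near cover with the edges `{F^s_i, F^t_{π(i)}}`. In the near cover of a cochain `f`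
the vertex `[t,j]` is joined to `[s, f(s,t) j]`, so that this value is `π⁻¹`. -/
noncomputable def queryCoverEdge (s t : {s // s ∈ X.dimFaces k}) :
    QueryTree (X.ListQuery k l) (X.ListAnswer k l) (Equiv.Perm (Fin l)) :=
  (X.queryList k l s).bind fun a => (X.queryList k l t).bind fun b =>
    .leaf (coverPerm a b)⁻¹

open scoped Classical in
/-- Query both lists and accept iff the edge is adequately covered. -/
noncomputable def adequateTree (s t : {s // s ∈ X.dimFaces k}) :
    QueryTree (X.ListQuery k l) (X.ListAnswer k l) Bool :=
  (X.queryList k l s).bind fun a => (X.queryList k l t).bind fun b =>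
    .leaf (decide (∃ π, Matches a b π))

/-- Check whether an edge of the representation complex (with some fixed orientation) is adequately
covered. -/
noncomputable def adequateEdgeTree (e : {e // e ∈ (X.rep k).dimFaces 1}) :
    QueryTree (X.ListQuery k l) (X.ListAnswer k l) Bool :=
  have h : ∃ p : Finset V × Finset V, e.1 = {p.1, p.2} := by
    obtain ⟨u, v, _, h⟩ := Finset.card_eq_two.1 (Finset.mem_filter.1 e.2).2
    exact ⟨(u, v), h⟩
  have h1 : h.choose.1 ∈ e.1 :=
    (Finset.ext_iff.1 h.choose_spec _).2 (Finset.mem_insert_self _ _)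
  have h2 : h.choose.2 ∈ e.1 :=
    (Finset.ext_iff.1 h.choose_spec _).2
      (Finset.mem_insert_of_mem (Finset.mem_singleton_self _))
  X.adequateTree k l ⟨h.choose.1, mem_dimFaces_of_mem_rep e.2 h1⟩
    ⟨h.choose.2, mem_dimFaces_of_mem_rep e.2 h2⟩

/-- The test for list agreement: with probability `1/2` run the empty triangle test with
coefficients in `S_l`, answering its queries by `queryCoverEdge`; with probability `1/2` sample an
edge of the representation complex and check whether it is adequately covered. -/
noncomputable def listAgreementTest (hk : 1 ≤ k) (h : k + 3 ≤ X.rank) :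
    Tester (X.ListQuery k l) (X.ListAnswer k l) :=
  Tester.mix
    (PMF.map (fun T => T.simulate fun q => X.queryCoverEdge k l
        ⟨q.1.1, mem_dimFaces_of_mem_rep q.2 (Finset.mem_insert_self _ _)⟩
        ⟨q.1.2, mem_dimFaces_of_mem_rep q.2
          (Finset.mem_insert_of_mem (Finset.mem_singleton_self _))⟩)
      (X.emptyTriangleTest (Equiv.Perm (Fin l)) k hk h))
    (PMF.map (X.adequateEdgeTree k l) ((X.rep k).sampleFace 1 (X.le_rank_rep k 0 (by omega))))

end ListTest

end FinComplex

/-! Everything is measured by unions. A face of positive dimension of the representation complex is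
the same thing as the pair of its core K and its union U, and its weight is the weight of U in X
divided by the number of possible cores (`weight_rep`). So it suffices to compare masses of sets U
that carry a defective edge, triangle or empty triangle, up to factors depending on k.

Coboundary testability is an induction on k (`exists_potential`). For a set K of k elements, the
k-faces K ∪ {a} are the vertices of the link of K, and a 1-cochain f restricts to a 1-cochain of
this link. Expansion of the link gives a potential h_K with f = d₀ h_K on most edges with core K. A
k-face σ thus receives one value h_K(σ) from each of its facets K, and these values have to be
reconciled. The discrepancies h_K(K ∪ L)⁻¹ h_L(K ∪ L) form a 1-cochain one dimension lower. Its
product around an empty triangle telescopes, because the three pairwise unions coincide. Its product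
around a triangle is, wherever f agrees with the local potentials, conjugate to the product of f
around the empty triangle of the pairwise unions (`triangleDefect_gluing`); this is why the empty
triangles are tested. By induction the discrepancy is close to some d₀ g, which says that h_K(σ)
g(K) does not depend on K for most σ. The common value is a global potential for f
(`edgeDefect_of_gluing`).

For list agreement, the matching permutations along the edges form a 1-cochain over S_l. The
intersection of adjacent faces misses only one vertex of each, so functions of a list that differ at
two vertices stay different on it, and a matching permutation is unique. The simulated triangle test
then bounds the distance of this cochain from some d₀ h. Numbering the list of s by h(s) produces l
ordinary assignments, and each of them is consistent across every edge that has a matching and on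
which the cochain equals d₀ h (`upRejectProb_le_of_coverCochain`). The 1-up test samples precisely
such edges, so agreement expansion bounds the distance of each assignment from agreeing, and
averaging over the l assignments bounds the distance of the lists. -/

namespace FinComplex

/-! ### Weights of faces in the representation complex and in links -/

section Weights

variable {V : Type*} [DecidableEq V] {X : FinComplex V}

/-- The sets `K ∪ {v}` with `v ∈ T \ K`. -/
def star (K T : Finset V) : Finset (Finset V) := (T \ K).image (fun v => insert v K)

theorem mem_star {K T a : Finset V} : a ∈ star K T ↔ ∃ v ∈ T, v ∉ K ∧ insert v K = a := by
  simp [star, and_assoc]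

theorem insert_injOn_compl {K : Finset V} {v w : V} (hv : v ∉ K)
    (h : insert v K = insert w K) : v = w := by
  have : v ∈ insert w K := h ▸ Finset.mem_insert_self v K
  exact (Finset.mem_insert.1 this).resolve_right hv

theorem card_star (K T : Finset V) : (star K T).card = (T \ K).card :=
  Finset.card_image_of_injOn fun _ hv _ _ h =>
    insert_injOn_compl (Finset.mem_sdiff.1 (Finset.mem_coe.1 hv)).2 h

theorem repUnion_star {K T : Finset V} (hKT : K ⊂ T) : repUnion (star K T) = T := by
  obtain ⟨v, hvT, hvK⟩ := Finset.exists_of_ssubset hKT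
  have hs := hKT.1
  ext x
  simp only [repUnion, Finset.mem_biUnion, id, mem_star]
  constructor
  · rintro ⟨a, ⟨w, hw, -, rfl⟩, hx⟩
    rcases Finset.mem_insert.1 hx with rfl | hx
    exacts [hw, hs hx]
  · intro hx
    by_cases hxK : x ∈ K
    · exact ⟨_, ⟨v, hvT, hvK, rfl⟩, Finset.mem_insert_of_mem hxK⟩
    · exact ⟨_, ⟨x, hx, hxK, rfl⟩, Finset.mem_insert_self _ _⟩

/-- Two members of the star already intersect in exactly K. With a single member the core would be
that member, hence the hypothesis. -/
theorem core_star {K T : Finset V} (h : 1 < (T \ K).card) : core (star K T) = K := by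
  obtain ⟨v, hv, w, hw, hvw⟩ := Finset.one_lt_card.1 h
  obtain ⟨hv1, hv2⟩ := Finset.mem_sdiff.1 hv
  obtain ⟨hw1, hw2⟩ := Finset.mem_sdiff.1 hw
  have mv : insert v K ∈ star K T := mem_star.2 ⟨v, hv1, hv2, rfl⟩
  have mw : insert w K ∈ star K T := mem_star.2 ⟨w, hw1, hw2, rfl⟩
  ext x
  constructor
  · intro hx
    have h1 := core_subset mv hx
    have h2 := core_subset mw hx
    grind
  · intro hx
    refine Finset.mem_filter.2
      ⟨Finset.mem_biUnion.2 ⟨_, mv, Finset.mem_insert_of_mem hx⟩, fun t ht => ?_⟩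
    obtain ⟨u, -, -, rfl⟩ := mem_star.1 ht
    exact Finset.mem_insert_of_mem hx

theorem ssubset_of_card_sdiff {K T : Finset V} (hKT : K ⊆ T) (h : 0 < (T \ K).card) : K ⊂ T := by
  refine hKT.ssubset_of_ne ?_
  rintro rfl
  simp at h

theorem star_mem_rep {K T : Finset V} {k i : ℕ} (hT : T ∈ X.faces) (hKT : K ⊆ T)
    (hK : K.card = k) (hTc : T.card = k + (i + 2)) : star K T ∈ (X.rep k).dimFaces (i + 1) := by
  have hc : (T \ K).card = i + 2 := by rw [Finset.card_sdiff_of_subset hKT]; omega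
  rw [mem_rep_dimFaces, repUnion_star (ssubset_of_card_sdiff hKT (by omega)),
    core_star (by omega), card_star]
  refine ⟨fun a ha => ?_, hc, hT, by omega, hK⟩
  obtain ⟨v, hv, hvK, rfl⟩ := mem_star.1 ha
  exact Finset.mem_filter.2 ⟨X.down_closed _ hT _ (Finset.insert_subset hv hKT),
    by rw [Finset.card_insert_of_notMem hvK, hK]⟩

theorem core_subset_repUnion (s : Finset (Finset V)) : core s ⊆ repUnion s :=
  Finset.filter_subset _ _

/-- Each member has one element more than the core, so it is the core with one point of the union
added; by counting, every such set occurs. Together with `star_mem_rep` this identifies faces of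
positive dimension with pairs of a core and a union. -/
theorem star_core_repUnion {k i : ℕ} {s : Finset (Finset V)}
    (hs : s ∈ (X.rep k).dimFaces (i + 1)) : star (core s) (repUnion s) = s := by
  obtain ⟨h1, h2, h3, h4, h5⟩ := mem_rep_dimFaces.1 hs
  symm
  refine Finset.eq_of_subset_of_card_le (fun a ha => ?_) ?_
  · have hac := (Finset.mem_filter.1 (h1 ha)).2
    have : (a \ core s).card = 1 := by
      rw [Finset.card_sdiff_of_subset (core_subset ha)]; omega
    obtain ⟨v, hv⟩ := Finset.card_eq_one.1 this
    have hv' : v ∈ a \ core s := by simp [hv]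
    obtain ⟨hva, hvc⟩ := Finset.mem_sdiff.1 hv'
    refine mem_star.2 ⟨v, Finset.mem_biUnion.2 ⟨a, ha, hva⟩, hvc, ?_⟩
    rw [← Finset.sdiff_union_of_subset (core_subset ha), hv]
    rfl
  · rw [card_star, Finset.card_sdiff_of_subset (core_subset_repUnion s)]
    omega

/-- The core can only shrink when the family grows, and both cores have k elements. -/
theorem core_eq_of_subset {k i j : ℕ} {s t : Finset (Finset V)}
    (hs : s ∈ (X.rep k).dimFaces (i + 1)) (ht : t ∈ (X.rep k).dimFaces (j + 1)) (hst : s ⊆ t) :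
    core t = core s := by
  obtain ⟨-, h2, -, -, h5⟩ := mem_rep_dimFaces.1 hs
  obtain ⟨-, -, -, -, h5'⟩ := mem_rep_dimFaces.1 ht
  refine Finset.eq_of_subset_of_card_le (fun v hv => ?_) (by omega)
  obtain ⟨a, ha⟩ := Finset.card_pos.1 (show 0 < s.card by omega)
  exact Finset.mem_filter.2 ⟨Finset.mem_biUnion.2 ⟨a, ha, core_subset (hst ha) hv⟩,
    fun b hb => core_subset (hst hb) hv⟩

theorem rank_rep {k : ℕ} (h : k + 2 ≤ X.rank) : (X.rep k).rank = X.rank - k := by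
  refine le_antisymm (Finset.sup_le fun s hs => ?_) ?_
  · rcases (Finset.mem_filter.1 hs).2 with h1 | ⟨h1, h2, -⟩
    · omega
    · have := X.card_le_rank h1
      omega
  · obtain ⟨i, hi⟩ := Nat.exists_eq_add_of_le h
    have := X.le_rank_rep k i (by omega)
    omega

theorem mem_topFaces_rep {k i : ℕ} (h : k + (i + 2) = X.rank) {s : Finset (Finset V)} :
    s ∈ (X.rep k).topFaces ↔ s ∈ (X.rep k).dimFaces (i + 1) := by
  have := rank_rep (X := X) (k := k) (by omega)
  have h2 : X.rank - k = i + 1 + 1 := by omega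
  simp only [topFaces, dimFaces, Finset.mem_filter, this, h2]

/-- A top face above `s` has the same core as `s`, so it is determined by its union, which may be
any top face of X containing the union of `s`. -/
theorem card_topFaces_rep_superset {k i : ℕ} (hk : k + 2 ≤ X.rank) {s : Finset (Finset V)}
    (hs : s ∈ (X.rep k).dimFaces (i + 1)) :
    ((X.rep k).topFaces.filter (fun t => s ⊆ t)).card =
      (X.topFaces.filter (fun T => repUnion s ⊆ T)).card := by
  obtain ⟨m, hm⟩ := Nat.exists_eq_add_of_le hk
  have hm : k + (m + 2) = X.rank := by omega
  obtain ⟨h1, h2, h3, h4, h5⟩ := mem_rep_dimFaces.1 hs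
  refine Finset.card_bij' (fun t _ => repUnion t) (fun T _ => star (core s) T) ?_ ?_ ?_ ?_
  · intro t ht
    obtain ⟨ht, hst⟩ := Finset.mem_filter.1 ht
    obtain ⟨-, ht2, ht3, ht4, -⟩ := mem_rep_dimFaces.1 ((mem_topFaces_rep hm).1 ht)
    exact Finset.mem_filter.2 ⟨Finset.mem_filter.2 ⟨ht3, by omega⟩,
      Finset.biUnion_subset_biUnion_of_subset_left _ hst⟩
  · intro T hT
    obtain ⟨hT, hsT⟩ := Finset.mem_filter.1 hT
    obtain ⟨hT1, hT2⟩ := Finset.mem_filter.1 hT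
    refine Finset.mem_filter.2 ⟨(mem_topFaces_rep hm).2
      (star_mem_rep hT1 ((core_subset_repUnion s).trans hsT) h5 (by omega)), fun a ha => ?_⟩
    rw [← star_core_repUnion hs] at ha
    obtain ⟨v, hv, hvK, rfl⟩ := mem_star.1 ha
    exact mem_star.2 ⟨v, hsT hv, hvK, rfl⟩
  · intro t ht
    obtain ⟨ht, hst⟩ := Finset.mem_filter.1 ht
    have ht := (mem_topFaces_rep hm).1 ht
    rw [← core_eq_of_subset hs ht hst]
    exact star_core_repUnion ht
  · intro T hT
    obtain ⟨hT, hsT⟩ := Finset.mem_filter.1 hT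
    obtain ⟨hT1, hT2⟩ := Finset.mem_filter.1 hT
    have hKT := (core_subset_repUnion s).trans hsT
    refine repUnion_star (ssubset_of_card_sdiff hKT ?_)
    rw [Finset.card_sdiff_of_subset hKT]
    omega

/-- Top faces correspond to pairs of a top face T of X and a core of k elements in T. -/
theorem card_topFaces_rep {k : ℕ} (hk : k + 2 ≤ X.rank) :
    (X.rep k).topFaces.card = X.topFaces.card * X.rank.choose k := by
  obtain ⟨m, hm⟩ := Nat.exists_eq_add_of_le hk
  have hm : k + (m + 2) = X.rank := by omega
  have : ∀ T ∈ X.topFaces, (T.powersetCard k).card = X.rank.choose k := fun T hT => by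
    rw [Finset.card_powersetCard, (Finset.mem_filter.1 hT).2]
  rw [← smul_eq_mul, ← Finset.sum_const, ← Finset.sum_congr rfl this, ← Finset.card_sigma]
  refine Finset.card_bij' (fun t _ => (⟨repUnion t, core t⟩ : (_ : Finset V) × Finset V))
    (fun p _ => star p.2 p.1) ?_ ?_ ?_ ?_
  · intro t ht
    obtain ⟨-, ht2, ht3, ht4, ht5⟩ := mem_rep_dimFaces.1 ((mem_topFaces_rep hm).1 ht)
    exact Finset.mem_sigma.2 ⟨Finset.mem_filter.2 ⟨ht3, by dsimp only; omega⟩,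
      Finset.mem_powersetCard.2 ⟨core_subset_repUnion t, ht5⟩⟩
  · rintro ⟨T, K⟩ h
    obtain ⟨hT, hK⟩ := Finset.mem_sigma.1 h
    obtain ⟨hT1, hT2⟩ := Finset.mem_filter.1 hT
    obtain ⟨hK1, hK2⟩ := Finset.mem_powersetCard.1 hK
    exact (mem_topFaces_rep hm).2 (star_mem_rep hT1 hK1 hK2 (by omega))
  · exact fun t ht => star_core_repUnion ((mem_topFaces_rep hm).1 ht)
  · rintro ⟨T, K⟩ h
    obtain ⟨hT, hK⟩ := Finset.mem_sigma.1 h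
    obtain ⟨hT1, hT2⟩ := Finset.mem_filter.1 hT
    obtain ⟨hK1, hK2⟩ := Finset.mem_powersetCard.1 hK
    dsimp only at hT1 hT2 hK1 hK2 ⊢
    have hc : (T \ K).card = m + 2 := by rw [Finset.card_sdiff_of_subset hK1]; omega
    rw [repUnion_star (ssubset_of_card_sdiff hK1 (by omega)), core_star (by omega)]

theorem card_topFaces_pos : (0 : ℝ) < X.topFaces.card := by
  exact_mod_cast Finset.card_pos.2 X.topFaces_nonempty

/-- The weight of a face of the representation complex: choose the union by its weight and then
the core uniformly. -/
theorem weight_rep {k i : ℕ} (hk : k + 2 ≤ X.rank) {s : Finset (Finset V)}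
    (hs : s ∈ (X.rep k).dimFaces (i + 1)) :
    (X.rep k).weight s * ((k + (i + 2)).choose k : ℝ) = X.weight (repUnion s) := by
  obtain ⟨h1, h2, h3, h4, h5⟩ := mem_rep_dimFaces.1 hs
  have hr := X.card_le_rank h3
  rw [weight, weight, card_topFaces_rep_superset hk hs, card_topFaces_rep hk, rank_rep hk, h4, h2]
  -- Both sides count nested choices of a core inside a union inside a top face; this converts the
  -- normalisation in `rep` into the one in `X`.
  have e : X.rank.choose (k + (i + 2)) * (k + (i + 2)).choose k =
      X.rank.choose k * (X.rank - k).choose (i + 2) := by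
    rw [Nat.choose_mul]
    · congr 2; omega
    · omega
  have e' : (X.rank.choose (k + (i + 2)) : ℝ) * ((k + (i + 2)).choose k : ℝ) =
      (X.rank.choose k : ℝ) * ((X.rank - k).choose (i + 2) : ℝ) := by exact_mod_cast e
  have p1 : (0 : ℝ) < X.rank.choose (k + (i + 2)) := by
    exact_mod_cast Nat.choose_pos (by omega)
  have p2 : (0 : ℝ) < (X.rank - k).choose (i + 2) := by
    exact_mod_cast Nat.choose_pos (by omega)
  have p3 : (0 : ℝ) < X.rank.choose k := by exact_mod_cast Nat.choose_pos (by omega)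
  have p4 := card_topFaces_pos (X := X)
  have e3 : i + 1 + 1 + k = k + (i + 2) := by omega
  have e4 : i + 1 + 1 = i + 2 := by omega
  rw [e3, e4]
  push_cast
  rw [div_mul_eq_mul_div, div_eq_div_iff (by positivity) (by positivity)]
  linear_combination ((X.topFaces.filter (fun T => repUnion s ⊆ T)).card : ℝ) *
    (X.topFaces.card : ℝ) * e'

/-! Links -/

theorem mem_link_faces {K e : Finset V} {hK : K ∈ X.faces} :
    e ∈ (X.link K hK).faces ↔ Disjoint e K ∧ e ∪ K ∈ X.faces := by
  simp only [link, Finset.mem_image, Finset.mem_filter]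
  constructor
  · rintro ⟨t, ⟨ht, hKt⟩, rfl⟩
    exact ⟨Finset.sdiff_disjoint, by rwa [Finset.sdiff_union_of_subset hKt]⟩
  · rintro ⟨h1, h2⟩
    exact ⟨_, ⟨h2, Finset.subset_union_right⟩, by
      rw [Finset.union_sdiff_right, Finset.sdiff_eq_self_of_disjoint h1]⟩

/-- Purity puts K inside a face of maximal dimension, so no dimension is lost beyond the size of K.
-/
theorem rank_link (hX : X.IsPure) {K : Finset V} (hK : K ∈ X.faces) :
    (X.link K hK).rank = X.rank - K.card := by
  refine le_antisymm (Finset.sup_le fun e he => ?_) ?_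
  · obtain ⟨h1, h2⟩ := mem_link_faces.1 he
    have := X.card_le_rank h2
    rw [Finset.card_union_of_disjoint h1] at this
    omega
  · obtain ⟨T, hT, hKT⟩ := hX K hK
    obtain ⟨hT1, hT2⟩ := Finset.mem_filter.1 hT
    rw [← hT2, ← Finset.card_sdiff_of_subset hKT]
    exact card_le_rank _ (mem_link_faces.2 ⟨Finset.sdiff_disjoint,
      by rwa [Finset.sdiff_union_of_subset hKT]⟩)

/-- The bijection removes K from a top face of X; by purity what remains has the full dimension of
the link. -/
theorem card_topFaces_link_superset (hX : X.IsPure) {K e : Finset V} (hK : K ∈ X.faces)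
    (he : Disjoint e K) :
    ((X.link K hK).topFaces.filter (fun t => e ⊆ t)).card =
      (X.topFaces.filter (fun T => e ∪ K ⊆ T)).card := by
  have hr := X.card_le_rank hK
  refine Finset.card_bij' (fun t _ => t ∪ K) (fun T _ => T \ K) ?_ ?_ ?_ ?_
  · intro t ht
    obtain ⟨ht, het⟩ := Finset.mem_filter.1 ht
    obtain ⟨ht1, ht2⟩ := Finset.mem_filter.1 ht
    obtain ⟨hd, hf⟩ := mem_link_faces.1 ht1
    rw [rank_link hX] at ht2
    exact Finset.mem_filter.2 ⟨Finset.mem_filter.2 ⟨hf, by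
      rw [Finset.card_union_of_disjoint hd]; omega⟩, Finset.union_subset_union_left het⟩
  · intro T hT
    obtain ⟨hT, heT⟩ := Finset.mem_filter.1 hT
    obtain ⟨hT1, hT2⟩ := Finset.mem_filter.1 hT
    have hKT := Finset.subset_union_right.trans heT
    refine Finset.mem_filter.2 ⟨Finset.mem_filter.2 ⟨mem_link_faces.2 ⟨Finset.sdiff_disjoint, by
      rwa [Finset.sdiff_union_of_subset hKT]⟩, ?_⟩, ?_⟩
    · rw [rank_link hX, Finset.card_sdiff_of_subset hKT, hT2]
    · exact Finset.subset_sdiff.2 ⟨Finset.subset_union_left.trans heT, he⟩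
  · intro t ht
    obtain ⟨hd, -⟩ := mem_link_faces.1 (Finset.mem_filter.1 (Finset.mem_filter.1 ht).1).1
    rw [Finset.union_sdiff_right, Finset.sdiff_eq_self_of_disjoint hd]
  · intro T hT
    exact Finset.sdiff_union_of_subset
      (Finset.subset_union_right.trans (Finset.mem_filter.1 hT).2)

theorem weight_pos (hX : X.IsPure) {K : Finset V} (hK : K ∈ X.faces) : 0 < X.weight K := by
  obtain ⟨T, hT, hKT⟩ := hX K hK
  have p1 : (0 : ℝ) < X.rank.choose K.card := by
    exact_mod_cast Nat.choose_pos (X.card_le_rank hK)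
  have p2 : (0 : ℝ) < (X.topFaces.filter (fun t => K ⊆ t)).card := by
    exact_mod_cast Finset.card_pos.2 ⟨T, Finset.mem_filter.2 ⟨hT, hKT⟩⟩
  have p4 := card_topFaces_pos (X := X)
  unfold weight
  positivity

/-- Choosing K and then a face of its link amounts to choosing the union and then uniformly marking
K in it. -/
theorem weight_link (hX : X.IsPure) {K e : Finset V} (hK : K ∈ X.faces)
    (he : e ∈ (X.link K hK).faces) :
    (X.link K hK).weight e * (X.weight K * ((e.card + K.card).choose K.card : ℝ)) =
      X.weight (e ∪ K) := by
  obtain ⟨hd, hf⟩ := mem_link_faces.1 he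
  have hr := X.card_le_rank hf
  have hpos := weight_pos hX hK
  have hM : (X.link K hK).topFaces.card = (X.topFaces.filter (fun T => K ⊆ T)).card := by
    have := card_topFaces_link_superset hX hK (e := ∅) (by simp)
    simpa using this
  rw [Finset.card_union_of_disjoint hd] at hr
  rw [weight] at hpos ⊢
  rw [weight, weight, card_topFaces_link_superset hX hK hd, hM, rank_link hX,
    Finset.card_union_of_disjoint hd]
  have hC : X.rank.choose (e.card + K.card) * (e.card + K.card).choose K.card =
      X.rank.choose K.card * (X.rank - K.card).choose e.card := by
    rw [Nat.choose_mul]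
    · congr 2; omega
    · omega
  have hC' : (X.rank.choose (e.card + K.card) : ℝ) * ((e.card + K.card).choose K.card : ℝ) =
      (X.rank.choose K.card : ℝ) * ((X.rank - K.card).choose e.card : ℝ) := by exact_mod_cast hC
  have p1 : (0 : ℝ) < X.rank.choose (e.card + K.card) := by
    exact_mod_cast Nat.choose_pos (by omega)
  have p2 : (0 : ℝ) < (X.rank - K.card).choose e.card := by
    exact_mod_cast Nat.choose_pos (by omega)
  have p3 : (0 : ℝ) < X.rank.choose K.card := by exact_mod_cast Nat.choose_pos (by omega)
  have p4 := card_topFaces_pos (X := X)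
  have p5 : (0 : ℝ) < (X.topFaces.filter (fun T => K ⊆ T)).card := by
    by_contra hn
    have : ((X.topFaces.filter (fun T => K ⊆ T)).card : ℝ) = 0 :=
      le_antisymm (not_lt.1 hn) (by positivity)
    rw [this] at hpos
    simp at hpos
  rw [div_mul_eq_mul_div, div_mul_eq_mul_div, div_eq_div_iff (by positivity) (by positivity),
    mul_div_assoc', div_mul_eq_mul_div, div_eq_iff (by positivity)]
  linear_combination (((X.topFaces.filter (fun T => e ∪ K ⊆ T)).card : ℝ) *
    ((X.topFaces.filter (fun T => K ⊆ T)).card : ℝ) * (X.topFaces.card : ℝ)) * hC'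

/-- The norm of the faces of dimension `i` with the property `P`. -/
noncomputable def mass (X : FinComplex V) (i : ℕ) (P : Finset V → Prop) : ℝ :=
  open scoped Classical in X.norm ((X.dimFaces i).filter P)

end Weights

end FinComplex

namespace FinComplex

/-! ### Masses of properties of faces: union bounds, facets and links -/

section Mass

variable {V : Type*} [DecidableEq V] {X : FinComplex V}

theorem mass_eq_norm (i : ℕ) (P : Finset V → Prop) [DecidablePred P] :
    X.mass i P = X.norm ((X.dimFaces i).filter P) := by
  rw [mass]
  congr!

theorem mass_eq_sum (i : ℕ) (P : Finset V → Prop) [DecidablePred P] :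
    X.mass i P = ∑ U ∈ X.dimFaces i, if P U then X.weight U else 0 := by
  rw [mass_eq_norm, norm, Finset.sum_filter]

theorem mass_nonneg (i : ℕ) (P : Finset V → Prop) : 0 ≤ X.mass i P :=
  Finset.sum_nonneg fun _ _ => X.weight_nonneg _

theorem mass_mono {i : ℕ} {P Q : Finset V → Prop} (h : ∀ U ∈ X.dimFaces i, P U → Q U) :
    X.mass i P ≤ X.mass i Q := by
  classical
  rw [mass_eq_norm, mass_eq_norm]
  refine Finset.sum_le_sum_of_subset_of_nonneg (fun U hU => ?_) fun _ _ _ => X.weight_nonneg _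
  obtain ⟨h1, h2⟩ := Finset.mem_filter.1 hU
  exact Finset.mem_filter.2 ⟨h1, h U h1 h2⟩

theorem mass_or_le (i : ℕ) (P Q : Finset V → Prop) :
    X.mass i (fun U => P U ∨ Q U) ≤ X.mass i P + X.mass i Q := by
  classical
  rw [mass_eq_sum, mass_eq_sum, mass_eq_sum, ← Finset.sum_add_distrib]
  refine Finset.sum_le_sum fun U _ => ?_
  have := X.weight_nonneg U
  by_cases h1 : P U <;> by_cases h2 : Q U <;> simp [h1, h2, this]

theorem mass_exists_le_sum {ι : Type*} (S : Finset ι) (i : ℕ) (P : ι → Finset V → Prop) :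
    X.mass i (fun U => ∃ K ∈ S, P K U) ≤ ∑ K ∈ S, X.mass i (P K) := by
  classical
  simp_rw [mass_eq_sum]
  rw [Finset.sum_comm]
  refine Finset.sum_le_sum fun U _ => ?_
  have h0 : ∀ K ∈ S, 0 ≤ if P K U then X.weight U else 0 := fun K _ => by
    split_ifs
    exacts [X.weight_nonneg U, le_rfl]
  split_ifs with h
  · obtain ⟨K, hK, hP⟩ := h
    have := Finset.single_le_sum h0 hK
    rwa [if_pos hP] at this
  · exact Finset.sum_nonneg h0

/-- A face U of dimension i is counted at most once for each of its 2 ^ (i + 1) subsets K. -/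
theorem sum_mass_le (S : Finset (Finset V)) (i : ℕ) (P : Finset V → Finset V → Prop) :
    ∑ K ∈ S, X.mass i (fun U => K ⊆ U ∧ P K U) ≤
      2 ^ (i + 1) * X.mass i (fun U => ∃ K ∈ S, K ⊆ U ∧ P K U) := by
  classical
  simp_rw [mass_eq_sum]
  rw [Finset.sum_comm, Finset.mul_sum]
  refine Finset.sum_le_sum fun U hU => ?_
  rw [← Finset.sum_filter, Finset.sum_const, nsmul_eq_mul]
  split_ifs with h
  · refine mul_le_mul_of_nonneg_right ?_ (X.weight_nonneg U)
    have : (S.filter (fun K => K ⊆ U ∧ P K U)).card ≤ 2 ^ (i + 1) := by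
      rw [← card_of_mem_dimFaces hU, ← Finset.card_powerset]
      exact Finset.card_le_card fun K hK =>
        Finset.mem_powerset.2 (Finset.mem_filter.1 hK).2.1
    exact_mod_cast this
  · rw [Finset.filter_eq_empty_iff.2 fun K hK hP => h ⟨K, hK, hP⟩]
    simp

/-- Double count pairs U ⊆ t with t a top face: each t containing σ has `X.rank - (i + 1)` sets U
between σ and t, and the ratio of consecutive binomial coefficients turns this number into i + 2. -/
theorem sum_weight_superset_le {i : ℕ} {σ : Finset V} (hσ : σ ∈ X.dimFaces i) :
    ∑ U ∈ (X.dimFaces (i + 1)).filter (fun U => σ ⊆ U), X.weight U ≤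
      ((i : ℝ) + 2) * X.weight σ := by
  obtain ⟨hσ1, hσ2⟩ := Finset.mem_filter.1 hσ
  have hr := X.card_le_rank hσ1
  -- In the first case there are no (i+1)-faces and the sum is empty.
  rcases Nat.lt_or_ge X.rank (i + 2) with hlt | hge
  · rw [Finset.sum_eq_zero]
    · have := X.weight_nonneg σ
      positivity
    · intro U hU
      obtain ⟨hU1, hU2⟩ := Finset.mem_filter.1 (Finset.mem_filter.1 hU).1
      have := X.card_le_rank hU1
      omega
  have h1 : ∀ U ∈ (X.dimFaces (i + 1)).filter (fun U => σ ⊆ U), X.weight U =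
      ((X.topFaces.filter (fun t => U ⊆ t)).card : ℝ) /
        ((X.rank.choose (i + 2) : ℝ) * (X.topFaces.card : ℝ)) := by
    intro U hU
    rw [weight, card_of_mem_dimFaces (Finset.mem_filter.1 hU).1]
  rw [Finset.sum_congr rfl h1, ← Finset.sum_div, weight, hσ2]
  have h2 : ∑ U ∈ (X.dimFaces (i + 1)).filter (fun U => σ ⊆ U),
      (X.topFaces.filter (fun t => U ⊆ t)).card ≤
      (X.topFaces.filter (fun t => σ ⊆ t)).card * (X.rank - (i + 1)) := by
    have := Finset.sum_card_bipartiteAbove_eq_sum_card_bipartiteBelow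
      (s := (X.dimFaces (i + 1)).filter (fun U => σ ⊆ U)) (t := X.topFaces) (fun s t => s ⊆ t)
    unfold Finset.bipartiteAbove Finset.bipartiteBelow at this
    rw [this, ← smul_eq_mul, ← Finset.sum_const, Finset.sum_filter]
    refine Finset.sum_le_sum fun t ht => ?_
    split_ifs with hσt
    · obtain ⟨ht1, ht2⟩ := Finset.mem_filter.1 ht
      rw [← ht2, ← hσ2, ← Finset.card_sdiff_of_subset hσt, ← card_star]
      refine Finset.card_le_card fun U hU => ?_
      obtain ⟨hU, hUt⟩ := Finset.mem_filter.1 hU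
      obtain ⟨hU, hσU⟩ := Finset.mem_filter.1 hU
      have hc := card_of_mem_dimFaces hU
      obtain ⟨v, hv⟩ := Finset.card_eq_one.1 (show (U \ σ).card = 1 by
        rw [Finset.card_sdiff_of_subset hσU]; omega)
      obtain ⟨hv1, hv2⟩ := Finset.mem_sdiff.1 (show v ∈ U \ σ by simp [hv])
      refine mem_star.2 ⟨v, hUt hv1, hv2, ?_⟩
      rw [← Finset.sdiff_union_of_subset hσU, hv]
      rfl
    · rw [Finset.filter_eq_empty_iff.2]
      · simp
      · exact fun U hU hUt => hσt ((Finset.mem_filter.1 hU).2.trans hUt)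
  have h3 : (∑ U ∈ (X.dimFaces (i + 1)).filter (fun U => σ ⊆ U),
      ((X.topFaces.filter (fun t => U ⊆ t)).card : ℝ)) ≤
      ((X.topFaces.filter (fun t => σ ⊆ t)).card : ℝ) * ((X.rank - (i + 1) : ℕ) : ℝ) := by
    exact_mod_cast h2
  have h4 : (X.rank.choose (i + 2) : ℝ) * ((i : ℝ) + 2) =
      (X.rank.choose (i + 1) : ℝ) * ((X.rank - (i + 1) : ℕ) : ℝ) := by
    exact_mod_cast Nat.choose_succ_right_eq X.rank (i + 1)
  have p1 : (0 : ℝ) < X.rank.choose (i + 2) := by exact_mod_cast Nat.choose_pos hge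
  have p2 : (0 : ℝ) < X.rank.choose (i + 1) := by exact_mod_cast Nat.choose_pos (by omega)
  have p4 := card_topFaces_pos (X := X)
  rw [mul_div_assoc', div_le_div_iff₀ (by positivity) (by positivity)]
  have h5 := mul_le_mul_of_nonneg_right h3
    (show 0 ≤ (X.rank.choose (i + 1) : ℝ) * (X.topFaces.card : ℝ) by positivity)
  refine h5.trans (le_of_eq ?_)
  linear_combination -(((X.topFaces.filter (fun t => σ ⊆ t)).card : ℝ) *
    (X.topFaces.card : ℝ)) * h4

/-- A union bound over the facets σ with property Q, each charged to its (i+1)-dimensional cofaces.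
-/
theorem mass_exists_facet_le (i : ℕ) (Q : Finset V → Prop) :
    X.mass (i + 1) (fun U => ∃ σ ∈ X.dimFaces i, σ ⊆ U ∧ Q σ) ≤ ((i : ℝ) + 2) * X.mass i Q := by
  classical
  refine (mass_exists_le_sum (X.dimFaces i) (i + 1) fun σ U => σ ⊆ U ∧ Q σ).trans ?_
  rw [mass_eq_sum i Q, Finset.mul_sum]
  refine Finset.sum_le_sum fun σ hσ => ?_
  split_ifs with h
  · refine le_trans (le_of_eq ?_) (sum_weight_superset_le hσ)
    rw [mass_eq_sum, ← Finset.sum_filter]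
    simp [h]
  · rw [mass_eq_sum]
    simp [h]

/-- This is `weight_link` summed over the bijection e ↦ e ∪ K; it moves the norms in the expansion
inequality of a link into X. -/
theorem norm_link (hX : X.IsPure) {K : Finset V} (hK : K ∈ X.faces) {k i : ℕ}
    (hKc : K.card = k) (P : Finset V → Prop) [DecidablePred P] :
    (X.link K hK).norm (((X.link K hK).dimFaces i).filter P) *
        (X.weight K * ((i + 1 + k).choose k : ℝ)) =
      X.mass (k + i) (fun U => K ⊆ U ∧ P (U \ K)) := by
  rw [mass_eq_norm, norm, norm, Finset.sum_mul]
  refine Finset.sum_bij' (fun e _ => e ∪ K) (fun U _ => U \ K) ?_ ?_ ?_ ?_ ?_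
  · intro e he
    obtain ⟨he, hP⟩ := Finset.mem_filter.1 he
    obtain ⟨he, hc⟩ := Finset.mem_filter.1 he
    obtain ⟨hd, hf⟩ := mem_link_faces.1 he
    refine Finset.mem_filter.2 ⟨Finset.mem_filter.2 ⟨hf, ?_⟩, Finset.subset_union_right, ?_⟩
    · rw [Finset.card_union_of_disjoint hd]; omega
    · rwa [Finset.union_sdiff_right, Finset.sdiff_eq_self_of_disjoint hd]
  · intro U hU
    obtain ⟨hU, hKU, hP⟩ := Finset.mem_filter.1 hU
    obtain ⟨hU, hc⟩ := Finset.mem_filter.1 hU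
    refine Finset.mem_filter.2 ⟨Finset.mem_filter.2 ⟨mem_link_faces.2 ⟨Finset.sdiff_disjoint, ?_⟩,
      ?_⟩, hP⟩
    · rwa [Finset.sdiff_union_of_subset hKU]
    · rw [Finset.card_sdiff_of_subset hKU]; omega
  · intro e he
    obtain ⟨he, -⟩ := Finset.mem_filter.1 he
    obtain ⟨he, -⟩ := Finset.mem_filter.1 he
    obtain ⟨hd, -⟩ := mem_link_faces.1 he
    rw [Finset.union_sdiff_right, Finset.sdiff_eq_self_of_disjoint hd]
  · intro U hU
    obtain ⟨hU, hKU, hP⟩ := Finset.mem_filter.1 hU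
    exact Finset.sdiff_union_of_subset hKU
  · intro e he
    obtain ⟨he, -⟩ := Finset.mem_filter.1 he
    obtain ⟨he, hc⟩ := Finset.mem_filter.1 he
    rw [← weight_link hX hK he, hc, hKc]

end Mass

/-! ### Defects of a cochain and the potential on a single link -/

section Defects

variable {V : Type*} [DecidableEq V] {X : FinComplex V} {G : Type*} [Group G]

/-- The infimum is attained although V and G may be infinite: the norm takes only finitely many
values, one for each set of edges at most. -/
theorem exists_norm1_eq_distB1 (f : V → V → G) :
    ∃ h : V → G, X.norm1 (fun u v => f u v * (d0 h u v)⁻¹) = X.distB1 f := by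
  have hfin : (Set.range fun h : V → G => X.norm1 (fun u v => f u v * (d0 h u v)⁻¹)).Finite := by
    classical
    refine Set.Finite.subset ((X.dimFaces 1).powerset.image X.norm).finite_toSet ?_
    rintro _ ⟨h, rfl⟩
    exact Finset.mem_coe.2 (Finset.mem_image.2
      ⟨_, Finset.mem_powerset.2 (Finset.filter_subset _ _), rfl⟩)
  exact Set.Nonempty.csInf_mem (Set.range_nonempty _) hfin

theorem distB1_le (f : V → V → G) (h : V → G) :
    X.distB1 f ≤ X.norm1 (fun u v => f u v * (d0 h u v)⁻¹) :=
  ciInf_le ⟨0, by rintro _ ⟨h, rfl⟩; exact Finset.sum_nonneg fun _ _ => X.weight_nonneg _⟩ h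

/-- `U = K ∪ {a, b}` for some `K` of size `k` such that `f(K ∪ {a}, K ∪ {b}) ≠ 1`. -/
def EdgeDefect (k : ℕ) (f : Finset V → Finset V → G) (U : Finset V) : Prop :=
  ∃ K a b, K.card = k ∧ a ∉ K ∧ b ∉ K ∧ a ≠ b ∧ U = insert a (insert b K) ∧
    f (insert a K) (insert b K) ≠ 1

/-- `U = K ∪ {a, b, c}` for some `K` of size `k` such that `d₁ f ≠ 1` on the triangle of
`K ∪ {a}`, `K ∪ {b}`, `K ∪ {c}`. -/
def TriangleDefect (k : ℕ) (f : Finset V → Finset V → G) (U : Finset V) : Prop :=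
  ∃ K a b c, K.card = k ∧ a ∉ K ∧ b ∉ K ∧ c ∉ K ∧ a ≠ b ∧ a ≠ c ∧ b ≠ c ∧
    U = insert a (insert b (insert c K)) ∧
    f (insert a K) (insert b K) * f (insert b K) (insert c K) * f (insert c K) (insert a K) ≠ 1

/-- `U = L ∪ {a, b, c}` for some `L` of size `k - 1` such that `d₁ f ≠ 1` on the empty triangle of
`L ∪ {a, b}`, `L ∪ {b, c}`, `L ∪ {c, a}`. -/
def EmptyTriangleDefect (k : ℕ) (f : Finset V → Finset V → G) (U : Finset V) : Prop :=
  ∃ L a b c, L.card + 1 = k ∧ a ∉ L ∧ b ∉ L ∧ c ∉ L ∧ a ≠ b ∧ a ≠ c ∧ b ≠ c ∧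
    U = insert a (insert b (insert c L)) ∧
    f (insert a (insert b L)) (insert b (insert c L)) *
      f (insert b (insert c L)) (insert c (insert a L)) *
      f (insert c (insert a L)) (insert a (insert b L)) ≠ 1

/-- `U = K ∪ {a, b}` for some `K` of size `k` such that on the edge of `K ∪ {a}`, `K ∪ {b}` the
cochain `f` is not the coboundary of the function `h K`. -/
def LocalDefect (k : ℕ) (f : Finset V → Finset V → G) (h : Finset V → Finset V → G)
    (U : Finset V) : Prop :=
  ∃ K a b, K.card = k ∧ a ∉ K ∧ b ∉ K ∧ a ≠ b ∧ U = insert a (insert b K) ∧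
    f (insert a K) (insert b K) ≠ h K (insert a K) * (h K (insert b K))⁻¹

theorem pair_mem_rep {k : ℕ} {K : Finset V} {a b : V} (hK : K.card = k) (ha : a ∉ K) (hb : b ∉ K)
    (hab : a ≠ b) (hU : insert a (insert b K) ∈ X.faces) :
    ({insert a K, insert b K} : Finset (Finset V)) ∈ (X.rep k).dimFaces 1 := by
  have h1 : K ⊆ insert a (insert b K) := by intro; grind
  have h2 : (insert a (insert b K)).card = k + 2 := by
    rw [Finset.card_insert_of_notMem (by grind), Finset.card_insert_of_notMem hb, hK]
  convert star_mem_rep (i := 0) hU h1 hK h2 using 1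
  ext x
  rw [mem_star]
  simp only [Finset.mem_insert, Finset.mem_singleton]
  constructor
  · rintro (rfl | rfl)
    · exact ⟨a, by simp, ha, rfl⟩
    · exact ⟨b, by simp, hb, rfl⟩
  · rintro ⟨v, hv, hvK, rfl⟩
    grind

theorem triple_mem_rep {k : ℕ} {K : Finset V} {a b c : V} (hK : K.card = k) (ha : a ∉ K)
    (hb : b ∉ K) (hc : c ∉ K) (hab : a ≠ b) (hac : a ≠ c) (hbc : b ≠ c)
    (hU : insert a (insert b (insert c K)) ∈ X.faces) :
    ({insert a K, insert b K, insert c K} : Finset (Finset V)) ∈ (X.rep k).dimFaces 2 := by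
  have h1 : K ⊆ insert a (insert b (insert c K)) := by intro; grind
  have h2 : (insert a (insert b (insert c K))).card = k + 3 := by
    rw [Finset.card_insert_of_notMem (by grind), Finset.card_insert_of_notMem (by grind),
      Finset.card_insert_of_notMem hc, hK]
  convert star_mem_rep (i := 1) hU h1 hK h2 using 1
  ext x
  rw [mem_star]
  simp only [Finset.mem_insert, Finset.mem_singleton]
  constructor
  · rintro (rfl | rfl | rfl)
    · exact ⟨a, by simp, ha, rfl⟩
    · exact ⟨b, by simp, hb, rfl⟩
    · exact ⟨c, by simp, hc, rfl⟩
  · rintro ⟨v, hv, hvK, rfl⟩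
    grind

/-- The k-faces K ∪ {a} are indexed by the vertices a of the link of K, so f becomes a 1-cochain
there; `h` is a nearest coboundary potential for it, and both sides of the expansion inequality are
carried to X by `norm_link`. -/
theorem exists_link_potential (hX : X.IsPure) {K : Finset V} (hK : K ∈ X.faces) {k : ℕ}
    (hKc : K.card = k) {γ : ℝ} (hγ : 0 ≤ γ) (hexp : (X.link K hK).Expands1 G γ)
    {f : Finset V → Finset V → G} (hf : (X.rep k).IsCochain f) :
    ∃ h : V → G,
      γ * X.mass (k + 1) (fun U => K ⊆ U ∧ ∃ a b, a ∉ K ∧ b ∉ K ∧ a ≠ b ∧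
        U = insert a (insert b K) ∧ f (insert a K) (insert b K) ≠ h a * (h b)⁻¹) ≤
      X.mass (k + 2) (fun U => K ⊆ U ∧ ∃ a b c, a ∉ K ∧ b ∉ K ∧ c ∉ K ∧ a ≠ b ∧ a ≠ c ∧
        b ≠ c ∧ U = insert a (insert b (insert c K)) ∧ f (insert a K) (insert b K) *
          f (insert b K) (insert c K) * f (insert c K) (insert a K) ≠ 1) := by
  classical
  set φ : V → V → G := fun a b => f (insert a K) (insert b K) with hφ
  have hφc : (X.link K hK).IsCochain φ := by
    intro a b hab
    obtain ⟨h1, h2⟩ := Finset.mem_filter.1 hab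
    obtain ⟨hd, hU⟩ := mem_link_faces.1 h1
    have hne : a ≠ b := by rintro rfl; simp at h2
    have ha : a ∉ K := Finset.disjoint_left.1 hd (by simp)
    have hb : b ∉ K := Finset.disjoint_left.1 hd (by simp)
    refine hf _ _ (pair_mem_rep hKc ha hb hne ?_)
    convert hU using 1
    ext; simp
  obtain ⟨h, hh⟩ := exists_norm1_eq_distB1 (X := X.link K hK) φ
  refine ⟨h, ?_⟩
  have hle := hexp φ hφc
  rw [← hh] at hle
  have hw := weight_pos hX hK
  have e1 := norm_link hX hK (i := 1) hKc
    (fun s => ∃ u v, s = {u, v} ∧ φ u v * (d0 h u v)⁻¹ ≠ 1)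
  have e2 := norm_link hX hK (i := 2) hKc
    (fun s => ∃ u v w, s = {u, v, w} ∧ φ u v * φ v w * φ w u ≠ 1)
  have m1 : X.mass (k + 1) (fun U => K ⊆ U ∧ ∃ a b, a ∉ K ∧ b ∉ K ∧ a ≠ b ∧
        U = insert a (insert b K) ∧ f (insert a K) (insert b K) ≠ h a * (h b)⁻¹) ≤
      (X.link K hK).norm1 (fun u v => φ u v * (d0 h u v)⁻¹) *
        (X.weight K * ((1 + 1 + k).choose k : ℝ)) := by
    refine le_trans (mass_mono ?_) e1.ge
    rintro U - ⟨hKU, a, b, ha, hb, hab, rfl, hne⟩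
    refine ⟨hKU, a, b, by ext; grind, ?_⟩
    rwa [Ne, mul_inv_eq_one]
  have m2 : (X.link K hK).normd1 φ * (X.weight K * ((2 + 1 + k).choose k : ℝ)) ≤
      X.mass (k + 2) (fun U => K ⊆ U ∧ ∃ a b c, a ∉ K ∧ b ∉ K ∧ c ∉ K ∧ a ≠ b ∧ a ≠ c ∧
        b ≠ c ∧ U = insert a (insert b (insert c K)) ∧ f (insert a K) (insert b K) *
          f (insert b K) (insert c K) * f (insert c K) (insert a K) ≠ 1) := by
    refine le_trans e2.le (mass_mono ?_)
    rintro U hU ⟨hKU, a, b, c, he, hne⟩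
    have hc := card_of_mem_dimFaces hU
    have hc3 : ({a, b, c} : Finset V).card = 3 := by
      rw [← he, Finset.card_sdiff_of_subset hKU]; omega
    obtain ⟨hab, hac, hbc⟩ := ne_of_card_triple hc3
    have hU' : ∀ x, (x ∈ U ∧ x ∉ K) ↔ (x = a ∨ x = b ∨ x = c) := fun x => by
      rw [← Finset.mem_sdiff, he]; simp
    refine ⟨hKU, a, b, c, ((hU' a).2 (by simp)).2, ((hU' b).2 (by simp)).2,
      ((hU' c).2 (by simp)).2, hab, hac, hbc, ?_, hne⟩
    ext x
    have := hU' x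
    have := @hKU x
    simp only [Finset.mem_insert]
    tauto
  -- Edges and triangles of the link are rescaled by different binomial coefficients, but the one
  -- for edges is smaller, so no constant is lost.
  have hch : ((1 + 1 + k).choose k : ℝ) ≤ ((2 + 1 + k).choose k : ℝ) := by
    exact_mod_cast Nat.choose_le_choose k (by omega)
  have hB : 0 ≤ (X.link K hK).normd1 φ := Finset.sum_nonneg fun _ _ => weight_nonneg _ _
  calc _ ≤ γ * ((X.link K hK).norm1 (fun u v => φ u v * (d0 h u v)⁻¹) *
        (X.weight K * ((1 + 1 + k).choose k : ℝ))) := mul_le_mul_of_nonneg_left m1 hγ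
    _ = (γ * (X.link K hK).norm1 (fun u v => φ u v * (d0 h u v)⁻¹)) *
        (X.weight K * ((1 + 1 + k).choose k : ℝ)) := by ring
    _ ≤ (X.link K hK).normd1 φ * (X.weight K * ((2 + 1 + k).choose k : ℝ)) := by gcongr
    _ ≤ _ := m2

end Defects

end FinComplex

namespace FinComplex

/-! ### Gluing the local potentials by induction on the dimension -/

section Potential

variable {V : Type*} [DecidableEq V] {X : FinComplex V} {G : Type*} [Group G]

/-- Sum the link inequalities over all K. On the right a bad (k+2)-face is charged at most once per
subset K, and it has 2 ^ (k + 3) subsets. -/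
theorem exists_local_potential (hX : X.IsPure) {k : ℕ} {γ : ℝ} (hγ : 0 ≤ γ)
    (hexp : ∀ (K : Finset V) (hK : K ∈ X.faces), K.card = k → (X.link K hK).Expands1 G γ)
    {f : Finset V → Finset V → G} (hf : (X.rep k).IsCochain f) :
    ∃ h : Finset V → Finset V → G,
      γ * X.mass (k + 1) (LocalDefect k f h) ≤
        2 ^ (k + 3) * X.mass (k + 2) (TriangleDefect k f) := by
  classical
  have key : ∀ K : Finset V, ∃ h : V → G, K ∈ X.faces.filter (fun K => K.card = k) →
      γ * X.mass (k + 1) (fun U => K ⊆ U ∧ ∃ a b, a ∉ K ∧ b ∉ K ∧ a ≠ b ∧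
        U = insert a (insert b K) ∧ f (insert a K) (insert b K) ≠ h a * (h b)⁻¹) ≤
      X.mass (k + 2) (fun U => K ⊆ U ∧ ∃ a b c, a ∉ K ∧ b ∉ K ∧ c ∉ K ∧ a ≠ b ∧ a ≠ c ∧
        b ≠ c ∧ U = insert a (insert b (insert c K)) ∧ f (insert a K) (insert b K) *
          f (insert b K) (insert c K) * f (insert c K) (insert a K) ≠ 1) := by
    intro K
    by_cases hK : K ∈ X.faces.filter (fun K => K.card = k)
    · obtain ⟨h1, h2⟩ := Finset.mem_filter.1 hK
      obtain ⟨h, hh⟩ := exists_link_potential hX h1 h2 hγ (hexp K h1 h2) hf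
      exact ⟨h, fun _ => hh⟩
    · exact ⟨fun _ => 1, fun h => absurd h hK⟩
  choose p hp using key
  -- The link potential takes a vertex a, while the gluing needs a function of the face K ∪ {a}; the
  -- vertex is recovered from the face, and 1 is a value for pairs that never matter.
  let H : Finset V → Finset V → G := fun K σ =>
    if h : ∃ a, a ∉ K ∧ σ = insert a K then p K h.choose else 1
  have hH : ∀ K a, a ∉ K → H K (insert a K) = p K a := by
    intro K a ha
    have h : ∃ b, b ∉ K ∧ insert a K = insert b K := ⟨a, ha, rfl⟩
    have : H K (insert a K) = p K h.choose := dif_pos h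
    rw [this, ← insert_injOn_compl ha h.choose_spec.2]
  refine ⟨H, ?_⟩
  have h1 : X.mass (k + 1) (LocalDefect k f H) ≤
      ∑ K ∈ X.faces.filter (fun K => K.card = k), X.mass (k + 1) (fun U => K ⊆ U ∧ ∃ a b,
        a ∉ K ∧ b ∉ K ∧ a ≠ b ∧ U = insert a (insert b K) ∧
          f (insert a K) (insert b K) ≠ p K a * (p K b)⁻¹) := by
    refine le_trans (mass_mono ?_) (mass_exists_le_sum _ _ _)
    rintro U hU ⟨K, a, b, hK, ha, hb, hab, rfl, hne⟩
    have hsub : K ⊆ insert a (insert b K) := by intro; grind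
    refine ⟨K, Finset.mem_filter.2 ⟨X.down_closed _ (Finset.mem_filter.1 hU).1 _ hsub, hK⟩,
      hsub, a, b, ha, hb, hab, rfl, ?_⟩
    rwa [hH K a ha, hH K b hb] at hne
  have h2 := sum_mass_le (X := X) (X.faces.filter (fun K => K.card = k)) (k + 2)
    (fun K U => ∃ a b c, a ∉ K ∧ b ∉ K ∧ c ∉ K ∧ a ≠ b ∧ a ≠ c ∧
        b ≠ c ∧ U = insert a (insert b (insert c K)) ∧ f (insert a K) (insert b K) *
          f (insert b K) (insert c K) * f (insert c K) (insert a K) ≠ 1)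
  calc _ ≤ γ * _ := mul_le_mul_of_nonneg_left h1 hγ
    _ ≤ _ := by
      rw [Finset.mul_sum]
      exact Finset.sum_le_sum fun K hK => hp K hK
    _ ≤ _ := h2
    _ ≤ _ := by
      refine mul_le_mul_of_nonneg_left (mass_mono ?_) (by positivity)
      rintro U - ⟨K, hK, -, a, b, c, h⟩
      exact ⟨K, a, b, c, (Finset.mem_filter.1 hK).2, h⟩

/-- Two different facets cover σ, so by counting they meet in k elements and each has exactly one
point outside the other. -/
theorem exists_insert_pair {σ K L : Finset V} {k : ℕ} (hσ : σ.card = k + 2) (hK : K ⊆ σ)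
    (hL : L ⊆ σ) (hKc : K.card = k + 1) (hLc : L.card = k + 1) (hKL : K ≠ L) :
    ∃ M a b, M.card = k ∧ a ∉ M ∧ b ∉ M ∧ a ≠ b ∧ K = insert a M ∧ L = insert b M ∧
      σ = insert a (insert b M) := by
  have hu : K ∪ L ⊆ σ := Finset.union_subset hK hL
  have h1 := Finset.card_le_card hu
  have h2 := Finset.card_union_add_card_inter K L
  have h3 : K.card < (K ∪ L).card := by
    refine Finset.card_lt_card (Finset.subset_union_left.ssubset_of_ne fun h => hKL ?_)
    exact (Finset.eq_of_subset_of_card_le (Finset.union_eq_left.1 h.symm) (by omega)).symm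
  have hU : K ∪ L = σ := Finset.eq_of_subset_of_card_le hu (by omega)
  have e1 : (K \ L).card = 1 := by
    have := Finset.card_sdiff_add_card_inter K L
    omega
  have e2 : (L \ K).card = 1 := by
    have := Finset.card_sdiff_add_card_inter L K
    rw [Finset.inter_comm] at this
    omega
  obtain ⟨a, ha⟩ := Finset.card_eq_one.1 e1
  obtain ⟨b, hb⟩ := Finset.card_eq_one.1 e2
  have ha' : ∀ x, (x ∈ K ∧ x ∉ L) ↔ x = a := fun x => by
    rw [← Finset.mem_sdiff, ha, Finset.mem_singleton]
  have hb' : ∀ x, (x ∈ L ∧ x ∉ K) ↔ x = b := fun x => by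
    rw [← Finset.mem_sdiff, hb, Finset.mem_singleton]
  have haa := (ha' a).2 rfl
  have hbb := (hb' b).2 rfl
  refine ⟨K ∩ L, a, b, by omega, by simp [haa.2], by simp [hbb.2], ?_, ?_, ?_, ?_⟩
  · rintro rfl; exact haa.2 hbb.1
  · ext x; have := ha' x; simp only [Finset.mem_insert, Finset.mem_inter]; tauto
  · ext x; have := hb' x; simp only [Finset.mem_insert, Finset.mem_inter]; tauto
  · rw [← hU]
    ext x; have := ha' x; have := hb' x
    simp only [Finset.mem_insert, Finset.mem_inter, Finset.mem_union]; tauto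

/-- The constant of the bound in `exists_potential`. -/
noncomputable def potentialConst (γ : ℝ) : ℕ → ℝ
  | 0 => 2 ^ 3 / γ
  -- The first summand pays for local defects. The second is the number k + 3 of facets of a
  -- (k+2)-face times the inductive constant, applied to empty triangle defects plus local defects.
  | k + 1 => 2 ^ (k + 4) / γ + (k + 3) * potentialConst γ k * (1 + 2 ^ (k + 4) / γ)

theorem potentialConst_pos {γ : ℝ} (hγ : 0 < γ) (k : ℕ) : 0 < potentialConst γ k := by
  induction k with
  | zero => unfold potentialConst; positivity
  | succ k ih => unfold potentialConst; positivity

/-- The cochain on `X.rep k` obtained from functions `H K` on the faces containing `K`. -/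
def gluing (H : Finset V → Finset V → G) (K L : Finset V) : G :=
  (H K (K ∪ L))⁻¹ * H L (K ∪ L)

theorem gluing_insert (H : Finset V → Finset V → G) (M : Finset V) (a b : V) :
    gluing H (insert a M) (insert b M) =
      (H (insert a M) (insert a (insert b M)))⁻¹ * H (insert b M) (insert a (insert b M)) := by
  have : insert a M ∪ insert b M = insert a (insert b M) := by ext; simp; tauto
  rw [gluing, this]

/-- The vertices of an empty triangle have the same pairwise union, so the product telescopes. Hence
only genuine triangles contribute when the induction hypothesis is applied to the gluing cochain. -/
theorem not_emptyTriangleDefect_gluing (H : Finset V → Finset V → G) (k : ℕ) (U : Finset V) :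
    ¬ EmptyTriangleDefect k (gluing H) U := by
  rintro ⟨L, a, b, c, -, -, -, -, -, -, -, -, h⟩
  have e1 : insert a (insert b L) ∪ insert b (insert c L) = insert a (insert b (insert c L)) := by
    ext; simp only [Finset.mem_union, Finset.mem_insert]; tauto
  have e2 : insert b (insert c L) ∪ insert c (insert a L) = insert a (insert b (insert c L)) := by
    ext; simp only [Finset.mem_union, Finset.mem_insert]; tauto
  have e3 : insert c (insert a L) ∪ insert a (insert b L) = insert a (insert b (insert c L)) := by
    ext; simp only [Finset.mem_union, Finset.mem_insert]; tauto
  rw [gluing, gluing, gluing, e1, e2, e3] at h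
  exact h (by group)

/-- The pairwise unions of the triangle L ∪ {a}, L ∪ {b}, L ∪ {c} are the vertices of an empty
triangle one dimension up. If f equals the local potentials on its three edges, the product of f
there contains the same six values of H as the product of `gluing H`, only cyclically rotated. -/
theorem triangleDefect_gluing {k : ℕ} {f H : Finset V → Finset V → G} {U : Finset V}
    (h : TriangleDefect k (gluing H) U) :
    EmptyTriangleDefect (k + 1) f U ∨ LocalDefect (k + 1) f H U := by
  obtain ⟨L, a, b, c, hL, ha, hb, hc, hab, hac, hbc, rfl, hne⟩ := h
  by_contra hcon
  obtain ⟨hE, hloc⟩ := not_or.1 hcon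
  have hE : f (insert a (insert b L)) (insert b (insert c L)) *
      f (insert b (insert c L)) (insert c (insert a L)) *
      f (insert c (insert a L)) (insert a (insert b L)) = 1 := by
    by_contra h
    exact hE ⟨L, a, b, c, by omega, ha, hb, hc, hab, hac, hbc, rfl, h⟩
  -- The faces L ∪ {x, y} and L ∪ {y, z} meet in L ∪ {y}, so the potential that applies to this edge
  -- is the one at L ∪ {y}.
  have hl : ∀ x y z : V, x ∉ L → y ∉ L → z ∉ L → x ≠ y → x ≠ z → y ≠ z →
      insert x (insert y (insert z L)) = insert a (insert b (insert c L)) →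
      f (insert x (insert y L)) (insert y (insert z L)) =
        H (insert y L) (insert x (insert y L)) * (H (insert y L) (insert y (insert z L)))⁻¹ := by
    intro x y z hx hy hz hxy hxz hyz hU
    by_contra h
    refine hloc ⟨insert y L, x, z, ?_, ?_, ?_, hxz, ?_, ?_⟩
    · rw [Finset.card_insert_of_notMem hy, hL]
    · grind
    · grind
    · rw [← hU, Finset.insert_comm y z]
    · rwa [Finset.insert_comm z y]
  rw [hl a b c ha hb hc hab hac hbc rfl,
    hl b c a hb hc ha hbc hab.symm hac.symm (by ext; simp; tauto),
    hl c a b hc ha hb hac.symm hbc.symm hab (by ext; simp; tauto)] at hE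
  rw [gluing_insert, gluing_insert, gluing_insert] at hne
  apply hne
  set x1 := H (insert b L) (insert a (insert b L))
  set x2 := H (insert b L) (insert b (insert c L))
  set x3 := H (insert c L) (insert b (insert c L))
  set x4 := H (insert c L) (insert c (insert a L))
  set x5 := H (insert a L) (insert c (insert a L))
  set x6 := H (insert a L) (insert a (insert b L))
  -- Conjugating by `x6` moves the last factor of the product of f to the front, which gives the
  -- product of the gluing cochain.
  have : x6⁻¹ * (x1 * x2⁻¹ * (x3 * x4⁻¹) * (x5 * x6⁻¹)) * x6 = 1 := by rw [hE]; group
  rw [← this]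
  group

/-- If the gluing cochain equals d₀ g on all edges with union σ, then H K σ * g K is the same for
every facet K of σ, so the arbitrary choice `K₀ σ` is harmless. For an edge of f with core K both
end faces may then use K itself, and g K cancels. -/
theorem edgeDefect_of_gluing {k : ℕ} {f H : Finset V → Finset V → G} {g : Finset V → G}
    {K₀ : Finset V → Finset V}
    (hK₀ : ∀ σ, σ.card = k + 2 → K₀ σ ⊆ σ ∧ (K₀ σ).card = k + 1)
    {U : Finset V} (hU : U ∈ X.dimFaces (k + 2))
    (h : EdgeDefect (k + 1)
      (fun u v => f u v * (d0 (fun σ => H (K₀ σ) σ * g (K₀ σ)) u v)⁻¹) U) :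
    LocalDefect (k + 1) f H U ∨ ∃ σ ∈ X.dimFaces (k + 1), σ ⊆ U ∧
      EdgeDefect k (fun u v => gluing H u v * (d0 g u v)⁻¹) σ := by
  obtain ⟨K, a, b, hK, ha, hb, hab, rfl, hne⟩ := h
  by_contra hcon
  obtain ⟨hloc, hσ⟩ := not_or.1 hcon
  have hf : f (insert a K) (insert b K) = H K (insert a K) * (H K (insert b K))⁻¹ := by
    by_contra h
    exact hloc ⟨K, a, b, hK, ha, hb, hab, rfl, h⟩
  -- At an end face of the edge, the value defined through the chosen facet equals the value through
  -- the core K.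
  have key : ∀ c, c ∉ K → insert c K ⊆ insert a (insert b K) →
      H K (insert c K) * g K = H (K₀ (insert c K)) (insert c K) * g (K₀ (insert c K)) := by
    intro c hc hsub
    have hcc : (insert c K).card = k + 2 := by rw [Finset.card_insert_of_notMem hc, hK]
    obtain ⟨h1, h2⟩ := hK₀ _ hcc
    by_cases heq : K = K₀ (insert c K)
    · rw [← heq]
    obtain ⟨M, x, y, hM, hx, hy, hxy, e1, e2, e3⟩ :=
      exists_insert_pair hcc (Finset.subset_insert c K) h1 hK h2 heq
    by_contra h
    refine hσ ⟨insert c K, Finset.mem_filter.2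
      ⟨X.down_closed _ (Finset.mem_filter.1 hU).1 _ hsub, hcc⟩, hsub, M, x, y, hM, hx, hy, hxy,
      e3, fun hne => h ?_⟩
    beta_reduce at hne
    rw [gluing_insert, ← e3, ← e1, ← e2, mul_inv_eq_one, d0, inv_mul_eq_iff_eq_mul,
      ← mul_assoc, eq_mul_inv_iff_mul_eq] at hne
    exact hne.symm
  have ka := key a ha (by intro; grind)
  have kb := key b hb (by intro; grind)
  apply hne
  dsimp only [d0]
  rw [← ka, ← kb, hf]
  group

/-- A cochain of the representation complex is close to a coboundary if few triangles and few
empty triangles are violated. -/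
theorem exists_potential (hX : X.IsPure) {γ : ℝ} (hγ : 0 < γ) (k : ℕ)
    (hexp : ∀ (K : Finset V) (hK : K ∈ X.faces), K.card ≤ k → (X.link K hK).Expands1 G γ)
    {f : Finset V → Finset V → G} (hf : (X.rep k).IsCochain f) :
    ∃ h : Finset V → G,
      X.mass (k + 1) (EdgeDefect k (fun u v => f u v * (d0 h u v)⁻¹)) ≤
        potentialConst γ k * (X.mass (k + 2) (TriangleDefect k f) +
          X.mass (k + 1) (EmptyTriangleDefect k f)) := by
  induction k generalizing f with
  -- For k = 0 the only core is ∅, so the local potential is already global and nothing is glued.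
  | zero =>
    obtain ⟨H, hH⟩ := exists_local_potential hX hγ.le
      (fun K hK hKc => hexp K hK hKc.le) hf
    refine ⟨H ∅, ?_⟩
    have h1 : X.mass (0 + 1) (EdgeDefect 0 (fun u v => f u v * (d0 (H ∅) u v)⁻¹)) ≤
        X.mass (0 + 1) (LocalDefect 0 f H) := by
      refine mass_mono ?_
      rintro U - ⟨K, a, b, hK, ha, hb, hab, rfl, hne⟩
      obtain rfl := Finset.card_eq_zero.1 hK
      exact ⟨∅, a, b, hK, ha, hb, hab, rfl, by rwa [Ne, mul_inv_eq_one] at hne⟩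
    have h2 := mass_nonneg (X := X) (0 + 1) (EmptyTriangleDefect 0 f)
    rw [← le_div_iff₀' hγ] at hH
    refine (h1.trans hH).trans ?_
    rw [potentialConst, mul_div_right_comm]
    gcongr
    linarith
  | succ k ih =>
    obtain ⟨H, hH⟩ := exists_local_potential hX hγ.le
      (fun K hK hKc => hexp K hK hKc.le) hf
    have hc : (X.rep k).IsCochain (gluing H) := by
      intro u v _
      rw [gluing, gluing, Finset.union_comm v u]
      group
    -- The induction hypothesis is applied to the gluing cochain, not to f; its expansion
    -- requirement concerns only the smaller sets K.
    obtain ⟨g, hg⟩ := ih (fun K hK hKc => hexp K hK (by omega)) hc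
    have hempty : X.mass (k + 1) (EmptyTriangleDefect k (gluing H)) = 0 := by
      classical
      rw [mass_eq_sum]
      exact Finset.sum_eq_zero fun U _ => if_neg (not_emptyTriangleDefect_gluing H k U)
    rw [hempty, add_zero] at hg
    have htri : X.mass (k + 2) (TriangleDefect k (gluing H)) ≤
        X.mass (k + 2) (EmptyTriangleDefect (k + 1) f) +
          X.mass (k + 2) (LocalDefect (k + 1) f H) :=
      (mass_mono fun U _ => triangleDefect_gluing).trans (mass_or_le _ _ _)
    have hK₀ : ∀ σ : Finset V, ∃ K, σ.card = k + 2 → K ⊆ σ ∧ K.card = k + 1 := by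
      intro σ
      by_cases hσ : σ.card = k + 2
      · obtain ⟨K, hK⟩ := Finset.exists_subset_card_eq (s := σ) (n := k + 1) (by omega)
        exact ⟨K, fun _ => hK⟩
      · exact ⟨∅, fun h => absurd h hσ⟩
    choose K₀ hK₀ using hK₀
    refine ⟨fun σ => H (K₀ σ) σ * g (K₀ σ), ?_⟩
    have hfin : X.mass (k + 2) (EdgeDefect (k + 1)
        (fun u v => f u v * (d0 (fun σ => H (K₀ σ) σ * g (K₀ σ)) u v)⁻¹)) ≤
        X.mass (k + 2) (LocalDefect (k + 1) f H) + (((k + 1 : ℕ) : ℝ) + 2) *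
          X.mass (k + 1) (EdgeDefect k (fun u v => gluing H u v * (d0 g u v)⁻¹)) :=
      ((mass_mono fun U hU h => edgeDefect_of_gluing hK₀ hU h).trans (mass_or_le _ _ _)).trans
        (add_le_add_right (mass_exists_facet_le _ _) _)
    rw [← le_div_iff₀' hγ, mul_div_right_comm] at hH
    have hA := potentialConst_pos hγ k
    have ht := mass_nonneg (X := X) (k + 3) (TriangleDefect (k + 1) f)
    have he := mass_nonneg (X := X) (k + 2) (EmptyTriangleDefect (k + 1) f)
    change X.mass (k + 2) _ ≤ _ * (X.mass (k + 3) _ + X.mass (k + 2) _)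
    change X.mass (k + 2) _ ≤ 2 ^ (k + 4) / γ * X.mass (k + 3) _ at hH
    rw [potentialConst]
    set c : ℝ := 2 ^ (k + 4) / γ
    have hcpos : 0 < c := by positivity
    set A := potentialConst γ k
    set t := X.mass (k + 3) (TriangleDefect (k + 1) f)
    set e := X.mass (k + 2) (EmptyTriangleDefect (k + 1) f)
    calc _ ≤ _ := hfin
      _ ≤ c * t + (((k + 1 : ℕ) : ℝ) + 2) * (A * (e + c * t)) := by
        refine add_le_add hH (mul_le_mul_of_nonneg_left (hg.trans ?_) (by positivity))
        exact mul_le_mul_of_nonneg_left (htri.trans (by linarith)) hA.le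
      -- The recursive constant multiplies t + e as a whole; the three nonnegative products below
      -- are the slack in this rounding up.
      _ ≤ _ := by
        push_cast
        have h1 : 0 ≤ c * e := by positivity
        have h2 : 0 ≤ ((k : ℝ) + 3) * A * (c * e) := by positivity
        have h3 : 0 ≤ ((k : ℝ) + 3) * A * t := by positivity
        linarith

end Potential

end FinComplex

/-! ### Outputs and queries of composed decision trees -/

namespace QueryTree

variable {Q : Type*} {A : Q → Type*} {α β : Type*}

theorem eval_bind (O : (q : Q) → A q) (T : QueryTree Q A α) (f : α → QueryTree Q A β) :
    (T.bind f).eval O = (f (T.eval O)).eval O := by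
  induction T with
  | leaf a => rfl
  | ask q next ih => exact ih (O q)

theorem asked_bind [DecidableEq Q] (O : (q : Q) → A q) (T : QueryTree Q A α)
    (f : α → QueryTree Q A β) :
    (T.bind f).asked O = T.asked O ∪ (f (T.eval O)).asked O := by
  induction T with
  | leaf a => simp [bind, asked, eval]
  | ask q next ih => simp [bind, asked, eval, ih, Finset.insert_union]

theorem eval_simulate {Q' : Type*} {A' : Q' → Type*} (O : (q : Q') → A' q)
    (T : QueryTree Q A α) (S : (q : Q) → QueryTree Q' A' (A q)) :
    (T.simulate S).eval O = T.eval (fun q => (S q).eval O) := by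
  induction T with
  | leaf a => rfl
  | ask q next ih => simp [simulate, eval, eval_bind, ih]

theorem asked_simulate [DecidableEq Q] {Q' : Type*} [DecidableEq Q'] {A' : Q' → Type*}
    (O : (q : Q') → A' q) (T : QueryTree Q A α) (S : (q : Q) → QueryTree Q' A' (A q)) :
    (T.simulate S).asked O =
      (T.asked (fun q => (S q).eval O)).biUnion (fun q => (S q).asked O) := by
  induction T with
  | leaf a => rfl
  | ask q next ih => simp [simulate, asked, asked_bind, ih]

theorem eval_askAll (O : (q : Q) → A q) {n : ℕ} (q : Fin n → Q) :
    (askAll q : QueryTree Q A _).eval O = fun i => O (q i) := by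
  induction n with
  | zero => exact funext fun i => i.elim0
  | succ n ih =>
    simp only [askAll, eval, eval_bind, ih]
    funext i
    exact Fin.cases rfl (fun _ => rfl) i

theorem asked_askAll_subset [DecidableEq Q] (O : (q : Q) → A q) {n : ℕ} (q : Fin n → Q) :
    (askAll q : QueryTree Q A _).asked O ⊆ Finset.univ.image q := by
  induction n with
  | zero => exact Finset.empty_subset _
  | succ n ih =>
    simp only [askAll, asked, asked_bind, Finset.union_empty]
    refine Finset.insert_subset (Finset.mem_image_of_mem _ (Finset.mem_univ _)) ?_
    refine (ih fun i => q i.succ).trans fun x hx => ?_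
    obtain ⟨i, -, rfl⟩ := Finset.mem_image.1 hx
    exact Finset.mem_image_of_mem _ (Finset.mem_univ _)

end QueryTree

/-! ### Rejection probabilities of random decision trees -/

namespace Tester

variable {Q : Type*} {A : Q → Type*}

theorem rejectProb_eq_zero {T : Tester Q A} {O : (q : Q) → A q}
    (h : ∀ t ∈ T.support, t.eval O = true) : T.rejectProb O = 0 := by
  rw [rejectProb, (PMF.apply_eq_zero_iff _ _).2, ENNReal.toReal_zero]
  rw [PMF.support_map]
  rintro ⟨t, ht, hf⟩
  exact Bool.noConfusion ((h t ht).symm.trans hf)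

theorem rejectProb_map {ι : Type*} [Fintype ι] (p : PMF ι) (g : ι → QueryTree Q A Bool)
    (O : (q : Q) → A q) :
    rejectProb (PMF.map g p) O = ∑ i, if (g i).eval O = false then (p i).toReal else 0 := by
  classical
  rw [rejectProb, PMF.map_comp, PMF.map_apply, tsum_fintype, ENNReal.toReal_sum]
  · refine Finset.sum_congr rfl fun i _ => ?_
    by_cases h : (g i).eval O = false
    · simp [h]
    · simp [h]
  · intro i _
    split_ifs
    exacts [PMF.apply_ne_top p i, ENNReal.zero_ne_top]

theorem rejectProb_mix (S T : Tester Q A) (O : (q : Q) → A q) :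
    (mix S T).rejectProb O = (S.rejectProb O + T.rejectProb O) / 2 := by
  rw [rejectProb, mix, PMF.map_bind, PMF.bind_apply, tsum_fintype, ENNReal.toReal_sum]
  · simp [rejectProb]
    ring
  · intro b _
    exact ENNReal.mul_ne_top (PMF.apply_ne_top _ _) (PMF.apply_ne_top _ _)

theorem mem_support_mix {S T : Tester Q A} {t : QueryTree Q A Bool} :
    t ∈ (mix S T).support ↔ t ∈ S.support ∨ t ∈ T.support := by
  simp only [mix, PMF.mem_support_bind_iff, PMF.support_uniformOfFintype]
  simp [or_comm]

end Tester

namespace FinComplex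

/-! ### The empty triangle test bounds the distance from the coboundaries -/

section EmptyTriangleTest

variable {V : Type*} [DecidableEq V] {X : FinComplex V} {G : Type*} [Group G]

/-- This exposes the orientation that the tree fixes by choice, so that later arguments can work
with explicit vertices. -/
theorem triangleTree_spec [DecidableEq G] (Y : FinComplex V) (t : Finset V) (ht : t.card = 3)
    (he : ∀ u ∈ t, ∀ v ∈ t, u ≠ v → ({u, v} : Finset V) ∈ Y.dimFaces 1) :
    ∃ u v w, u ≠ v ∧ u ≠ w ∧ v ≠ w ∧ t = {u, v, w} ∧
      (∀ f : V → V → G, (triangleTree Y G t ht he).eval (Y.edgeOracle f) =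
        decide (f u v * f v w * f w u = 1)) ∧
      ∀ O : (e : Y.EdgeQuery) → G, ((triangleTree Y G t ht he).asked O).image Subtype.val =
        {(u, v), (v, w), (w, u)} := by
  have h : ∃ p : V × V × V, p.1 ≠ p.2.1 ∧ p.1 ≠ p.2.2 ∧ p.2.1 ≠ p.2.2 ∧
      t = {p.1, p.2.1, p.2.2} := by
    obtain ⟨u, v, w, h⟩ := Finset.card_eq_three.1 ht
    exact ⟨(u, v, w), h⟩
  have hs := h.choose_spec
  refine ⟨h.choose.1, h.choose.2.1, h.choose.2.2, hs.1, hs.2.1, hs.2.2.1, hs.2.2.2,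
    fun f => rfl, fun O => ?_⟩
  simp [triangleTree, QueryTree.asked]

theorem card_asked_triangleTree [DecidableEq G] (Y : FinComplex V) (t : Finset V)
    (ht : t.card = 3)
    (he : ∀ u ∈ t, ∀ v ∈ t, u ≠ v → ({u, v} : Finset V) ∈ Y.dimFaces 1)
    (O : (e : Y.EdgeQuery) → G) : ((triangleTree Y G t ht he).asked O).card = 3 := by
  obtain ⟨u, v, w, huv, huw, hvw, -, -, h⟩ := triangleTree_spec (G := G) Y t ht he
  rw [← Finset.card_image_of_injective _ Subtype.val_injective, h O, Finset.card_eq_three]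
  exact ⟨_, _, _, by simp [huv], by simp [huw], by simp [hvw], rfl⟩

theorem mem_of_mem_asked_triangleTree [DecidableEq G] {Y : FinComplex V} {t : Finset V}
    {ht : t.card = 3}
    {he : ∀ u ∈ t, ∀ v ∈ t, u ≠ v → ({u, v} : Finset V) ∈ Y.dimFaces 1}
    {O : (e : Y.EdgeQuery) → G} {q : Y.EdgeQuery} (hq : q ∈ (triangleTree Y G t ht he).asked O) :
    q.1.1 ∈ t ∧ q.1.2 ∈ t := by
  obtain ⟨u, v, w, -, -, -, rfl, -, h⟩ := triangleTree_spec (G := G) Y t ht he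
  have := h O ▸ Finset.mem_image_of_mem Subtype.val hq
  simp only [Finset.mem_insert, Finset.mem_singleton] at this
  rcases this with h | h | h <;> simp [h]

/-- Rotating the triangle conjugates the product and reversing it inverts the product, so triviality
does not depend on the orientation. -/
theorem triangle_eq_one {f : V → V → G} {u v w a b c : V}
    (hf : ∀ x ∈ ({u, v, w} : Finset V), ∀ y ∈ ({u, v, w} : Finset V), x ≠ y →
      f x y = (f y x)⁻¹)
    (hab : a ≠ b) (hac : a ≠ c) (hbc : b ≠ c) (h : ({a, b, c} : Finset V) = {u, v, w})
    (h1 : f u v * f v w * f w u = 1) : f a b * f b c * f c a = 1 := by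
  have ha : a ∈ ({u, v, w} : Finset V) := h ▸ by simp
  have hb : b ∈ ({u, v, w} : Finset V) := h ▸ by simp
  have hc : c ∈ ({u, v, w} : Finset V) := h ▸ by simp
  have e1 := hf a ha b hb hab
  have e2 := hf b hb c hc hbc
  have e3 := hf c hc a ha hac.symm
  -- The rotations `h1`, `r1`, `r2` settle the even orderings of the vertices; the odd ones are
  -- reduced to them by taking inverses.
  have r1 : f v w * f w u * f u v = 1 := by
    rw [mul_assoc] at h1
    exact mul_eq_one_comm.1 h1
  have r2 : f w u * f u v * f v w = 1 := by
    rw [mul_assoc] at r1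
    exact mul_eq_one_comm.1 r1
  simp only [Finset.mem_insert, Finset.mem_singleton] at ha hb hc
  rcases ha with rfl | rfl | rfl <;> rcases hb with rfl | rfl | rfl <;>
    first
    | exact absurd rfl hab
    | (rcases hc with rfl | rfl | rfl <;>
        first
        | exact absurd rfl hac
        | exact absurd rfl hbc
        | assumption
        | (rw [e1, e2, e3, ← inv_inj]
           first
           | simpa [mul_assoc] using h1
           | simpa [mul_assoc] using r1
           | simpa [mul_assoc] using r2))

theorem eval_triangleTree_eq_false [DecidableEq G] {Y : FinComplex V} {f : V → V → G}
    (hf : Y.IsCochain f) {t : Finset V} {ht : t.card = 3}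
    {he : ∀ u ∈ t, ∀ v ∈ t, u ≠ v → ({u, v} : Finset V) ∈ Y.dimFaces 1} {a b c : V}
    (h : t = {a, b, c}) (hne : f a b * f b c * f c a ≠ 1) :
    (triangleTree Y G t ht he).eval (Y.edgeOracle f) = false := by
  obtain ⟨u, v, w, huv, huw, hvw, h', hev, -⟩ := triangleTree_spec (G := G) Y t ht he
  obtain ⟨hab, hac, hbc⟩ := ne_of_card_triple (h ▸ ht)
  rw [hev, decide_eq_false_iff_not]
  refine fun h1 => hne (triangle_eq_one ?_ hab hac hbc (h.symm.trans h') h1)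
  rw [← h']
  exact fun x hx y hy hxy => hf x y (he x hx y hy hxy)

theorem eval_triangleTree_of_isCoboundary [DecidableEq G] {Y : FinComplex V} {f : V → V → G}
    (hf : Y.IsCoboundary f) {t : Finset V} {ht : t.card = 3}
    {he : ∀ u ∈ t, ∀ v ∈ t, u ≠ v → ({u, v} : Finset V) ∈ Y.dimFaces 1} :
    (triangleTree Y G t ht he).eval (Y.edgeOracle f) = true := by
  obtain ⟨u, v, w, huv, huw, hvw, h', hev, -⟩ := triangleTree_spec (G := G) Y t ht he
  obtain ⟨h, hh⟩ := hf
  subst h'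
  rw [hev, decide_eq_true_iff, hh u v (he u (by simp) v (by simp) huv),
    hh v w (he v (by simp) w (by simp) hvw), hh w u (he w (by simp) u (by simp) huw.symm)]
  simp [d0]

theorem mem_support_emptyTriangleTest [DecidableEq G] {k : ℕ} {hk : 1 ≤ k} {h : k + 3 ≤ X.rank}
    {T : QueryTree (X.rep k).EdgeQuery (fun _ => G) Bool}
    (hT : T ∈ (X.emptyTriangleTest G k hk h).support) :
    ∃ t ht he, T = triangleTree (X.rep k) G t ht he := by
  rcases Tester.mem_support_mix.1 hT with hT | hT
  all_goals
    obtain ⟨t, -, rfl⟩ := (PMF.mem_support_map_iff _ _ _).1 hT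
    exact ⟨_, _, _, rfl⟩

theorem sampleFace_toReal (i : ℕ) (h : i + 1 ≤ X.rank) (s : {s // s ∈ X.dimFaces i}) :
    (X.sampleFace i h s).toReal = X.weight s.1 := by
  rw [sampleFace, PMF.ofFintype_apply, ENNReal.toReal_ofReal (X.weight_nonneg _)]

theorem sampleEmptyTriangle_toReal (k : ℕ) (hk : 1 ≤ k) (h : k + 2 ≤ X.rank)
    (t : {t // t ∈ X.emptyTriangles k}) :
    (X.sampleEmptyTriangle k hk h t).toReal = (X.rep (k - 1)).weight (pairInter t.1) := by
  rw [sampleEmptyTriangle, PMF.ofFintype_apply, ENNReal.toReal_ofReal (weight_nonneg _ _)]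

/-- Pick a sample point `t` for each U with property P. Since U is recovered as φ t, different U
receive different points, and the weights can be compared term by term. -/
theorem mass_le_sum {ι : Type*} (S : Finset ι) (i : ℕ) (P : Finset V → Prop) (w : ι → ℝ)
    (hw : ∀ t ∈ S, 0 ≤ w t) (c : ℝ) (φ : ι → Finset V)
    (h : ∀ U ∈ X.dimFaces i, P U → ∃ t ∈ S, φ t = U ∧ X.weight U ≤ c * w t) (hc : 0 ≤ c) :
    X.mass i P ≤ c * ∑ t ∈ S, w t := by
  classical
  rcases isEmpty_or_nonempty ι with hι | hι
  · rw [mass_eq_norm, Finset.filter_eq_empty_iff.2 fun U hU hP => hι.false (h U hU hP).choose]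
    exact mul_nonneg hc (Finset.sum_nonneg hw)
  have : ∀ U ∈ (X.dimFaces i).filter P, ∃ t, t ∈ S ∧ φ t = U ∧ X.weight U ≤ c * w t :=
    fun U hU => h U (Finset.mem_filter.1 hU).1 (Finset.mem_filter.1 hU).2
  choose! g hg using this
  rw [mass_eq_norm, norm, Finset.mul_sum]
  calc _ ≤ ∑ U ∈ (X.dimFaces i).filter P, c * w (g U) :=
        Finset.sum_le_sum fun U hU => (hg U hU).2.2
    _ = ∑ t ∈ ((X.dimFaces i).filter P).image g, c * w t := by
        rw [Finset.sum_image]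
        intro U hU U' hU' he
        rw [← (hg U hU).2.1, ← (hg U' hU').2.1, he]
    _ ≤ _ := by
        refine Finset.sum_le_sum_of_subset_of_nonneg ?_
          fun t ht _ => mul_nonneg hc (hw t ht)
        intro t ht
        obtain ⟨U, hU, rfl⟩ := Finset.mem_image.1 ht
        exact (hg U hU).1

/-- The three faces are the pairwise unions of the triangle L ∪ {a}, L ∪ {b}, L ∪ {c} of
(k-1)-faces, so `pairUnion_mem` applies. -/
theorem exists_mem_emptyTriangles {k : ℕ} (hk : 1 ≤ k) {L : Finset V} {a b c : V}
    (hL : L.card + 1 = k) (ha : a ∉ L) (hb : b ∉ L) (hc : c ∉ L) (hab : a ≠ b) (hac : a ≠ c)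
    (hbc : b ≠ c) (hU : insert a (insert b (insert c L)) ∈ X.faces) :
    ∃ t ∈ X.emptyTriangles k, t = {insert a (insert b L), insert b (insert c L),
        insert c (insert a L)} ∧ pairInter t ∈ (X.rep (k - 1)).dimFaces 2 ∧
      repUnion (pairInter t) = insert a (insert b (insert c L)) := by
  have h := triple_mem_rep (X := X) (k := k - 1) (by omega) ha hb hc hab hac hbc hU
  obtain ⟨n1, n2, n3⟩ := ne_of_card_triple (card_of_mem_dimFaces h)
  obtain ⟨h1, h2⟩ := pairUnion_mem hk h
  refine ⟨_, h1, ?_, h2.symm ▸ h, ?_⟩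
  · rw [pairUnion_triple rfl n1 n2 n3]
    congr 1
    · ext; simp only [Finset.mem_union, Finset.mem_insert]; tauto
    congr 1
    · ext; simp only [Finset.mem_union, Finset.mem_insert]; tauto
    congr 1
    ext; simp only [Finset.mem_union, Finset.mem_insert]; tauto
  · rw [h2]
    ext x
    simp only [repUnion, Finset.mem_biUnion, Finset.mem_insert, Finset.mem_singleton, id,
      exists_eq_or_imp, exists_eq_left]
    tauto

/-- A defective U is the union of a violated triangle, or of the intersection triangle of a violated
empty triangle. The sampling weight is that of U divided by a binomial coefficient of size at most 2
^ (k + 3). The remaining factor 2 comes from the coin that selects between the two halves of the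
test. -/
theorem mass_defects_le_rejectProb [DecidableEq G] {k : ℕ} (hk : 1 ≤ k) (h : k + 3 ≤ X.rank)
    {f : Finset V → Finset V → G} (hf : (X.rep k).IsCochain f) :
    X.mass (k + 2) (TriangleDefect k f) + X.mass (k + 1) (EmptyTriangleDefect k f) ≤
      2 ^ (k + 4) * (X.emptyTriangleTest G k hk h).rejectProb ((X.rep k).edgeOracle f) := by
  rw [emptyTriangleTest, Tester.rejectProb_mix, Tester.rejectProb_map, Tester.rejectProb_map]
  simp_rw [sampleFace_toReal, sampleEmptyTriangle_toReal]
  have h1 : X.mass (k + 2) (TriangleDefect k f) ≤ 2 ^ (k + 3) *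
      ∑ t : {t // t ∈ (X.rep k).dimFaces 2}, if (triangleTree (X.rep k) G t.1
        (card_of_mem_dimFaces t.2) (pair_mem_of_mem_dimFaces t.2)).eval
          ((X.rep k).edgeOracle f) = false then (X.rep k).weight t.1 else 0 := by
    refine mass_le_sum _ _ _ _ (fun t _ => ?_) _ (fun t => repUnion t.1) ?_ (by positivity)
    · split_ifs
      exacts [weight_nonneg _ _, le_rfl]
    rintro U hU ⟨K, a, b, c, hK, ha, hb, hc, hab, hac, hbc, rfl, hne⟩
    have ht := triple_mem_rep hK ha hb hc hab hac hbc (Finset.mem_filter.1 hU).1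
    have hR : repUnion ({insert a K, insert b K, insert c K} : Finset (Finset V)) =
        insert a (insert b (insert c K)) := by
      ext x
      simp only [repUnion, Finset.mem_biUnion, Finset.mem_insert, Finset.mem_singleton, id,
        exists_eq_or_imp, exists_eq_left]
      tauto
    refine ⟨⟨_, ht⟩, Finset.mem_univ _, hR, ?_⟩
    rw [if_pos (eval_triangleTree_eq_false hf rfl hne), ← hR, ← weight_rep (by omega) ht, mul_comm]
    refine mul_le_mul_of_nonneg_right ?_ (weight_nonneg _ _)
    exact_mod_cast Nat.choose_le_two_pow _ _
  have h2 : X.mass (k + 1) (EmptyTriangleDefect k f) ≤ 2 ^ (k + 3) *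
      ∑ t : {t // t ∈ X.emptyTriangles k}, if (triangleTree (X.rep k) G t.1
        (Finset.mem_powersetCard.1 (Finset.mem_filter.1 t.2).1).2
        (Finset.mem_filter.1 t.2).2.1).eval ((X.rep k).edgeOracle f) = false
          then (X.rep (k - 1)).weight (pairInter t.1) else 0 := by
    refine mass_le_sum _ _ _ _ (fun t _ => ?_) _ (fun t => repUnion (pairInter t.1)) ?_
      (by positivity)
    · split_ifs
      exacts [weight_nonneg _ _, le_rfl]
    rintro U hU ⟨L, a, b, c, hL, ha, hb, hc, hab, hac, hbc, rfl, hne⟩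
    obtain ⟨t, ht, ht', hI, hR⟩ := exists_mem_emptyTriangles hk hL ha hb hc hab hac hbc
      (Finset.mem_filter.1 hU).1
    refine ⟨⟨t, ht⟩, Finset.mem_univ _, hR, ?_⟩
    rw [if_pos (eval_triangleTree_eq_false hf ht' hne), ← hR, ← weight_rep (by omega) hI, mul_comm]
    refine mul_le_mul_of_nonneg_right ?_ (weight_nonneg _ _)
    have e1 : (k - 1 + (1 + 2)).choose (k - 1) ≤ 2 ^ (k - 1 + (1 + 2)) :=
      Nat.choose_le_two_pow _ _
    have e2 : 2 ^ (k - 1 + (1 + 2)) ≤ 2 ^ (k + 3) := Nat.pow_le_pow_right (by omega) (by omega)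
    exact_mod_cast e1.trans e2
  have e : (2 : ℝ) ^ (k + 4) = 2 ^ (k + 3) * 2 := pow_succ _ _
  rw [e]
  linarith

theorem exists_insert_of_edge {k : ℕ} {u v : Finset V}
    (h : ({u, v} : Finset (Finset V)) ∈ (X.rep k).dimFaces 1) :
    ∃ K a b, K.card = k ∧ a ∉ K ∧ b ∉ K ∧ a ≠ b ∧ u = insert a K ∧ v = insert b K ∧
      repUnion {u, v} = insert a (insert b K) := by
  obtain ⟨h1, h2, h3, h4, h5⟩ := mem_rep_dimFaces.1 h
  have huv : u ≠ v := by rintro rfl; simp at h2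
  refine exists_insert_pair (by omega) ?_ ?_ (card_of_mem_dimFaces (h1 (by simp)))
    (card_of_mem_dimFaces (h1 (by simp))) huv
  · exact Finset.subset_biUnion_of_mem id (by simp)
  · exact Finset.subset_biUnion_of_mem id (by simp)

theorem repUnion_mem_dimFaces {k i : ℕ} {s : Finset (Finset V)}
    (hs : s ∈ (X.rep k).dimFaces (i + 1)) : repUnion s ∈ X.dimFaces (k + (i + 1)) := by
  obtain ⟨h1, h2, h3, h4, h5⟩ := mem_rep_dimFaces.1 hs
  exact Finset.mem_filter.2 ⟨h3, by omega⟩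

/-- The edges with a given union U are determined by their cores, so there are at most
`U.card.choose k` of them, and each has the weight of U divided by exactly this number. -/
theorem norm_rep_le {k : ℕ} (hk : k + 2 ≤ X.rank) {S : Finset (Finset (Finset V))}
    (hS : S ⊆ (X.rep k).dimFaces 1) {A : Finset (Finset V)} (hA : A ⊆ X.dimFaces (k + 1))
    (h : ∀ s ∈ S, repUnion s ∈ A) : (X.rep k).norm S ≤ X.norm A := by
  have hC : (0 : ℝ) < ((k + (0 + 2)).choose k : ℝ) := by
    exact_mod_cast Nat.choose_pos (by omega)
  refine le_of_mul_le_mul_right ?_ hC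
  have e : (X.rep k).norm S * ((k + (0 + 2)).choose k : ℝ) = ∑ s ∈ S, X.weight (repUnion s) := by
    rw [norm, Finset.sum_mul]
    exact Finset.sum_congr rfl fun s hs => weight_rep (i := 0) hk (hS hs)
  rw [e, ← Finset.sum_fiberwise_of_maps_to h, norm, Finset.sum_mul]
  refine Finset.sum_le_sum fun U hU => ?_
  have e2 : ∑ s ∈ S with repUnion s = U, X.weight (repUnion s) =
      ((S.filter (fun s => repUnion s = U)).card : ℝ) * X.weight U := by
    rw [← nsmul_eq_mul, ← Finset.sum_const]
    exact Finset.sum_congr rfl fun s hs => by rw [(Finset.mem_filter.1 hs).2]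
  rw [e2, mul_comm]
  refine mul_le_mul_of_nonneg_left ?_ (X.weight_nonneg U)
  have hUc := card_of_mem_dimFaces (hA hU)
  rw [show k + (0 + 2) = U.card by omega, ← Finset.card_powersetCard]
  refine Nat.cast_le.2 (le_trans (Finset.card_le_card fun s hs => ?_)
    (Finset.card_image_le (f := fun K => star K U)))
  obtain ⟨hsS, rfl⟩ := Finset.mem_filter.1 hs
  exact Finset.mem_image.2 ⟨core s, Finset.mem_powersetCard.2
    ⟨core_subset_repUnion s, (mem_rep_dimFaces.1 (hS hsS)).2.2.2.2⟩,
    star_core_repUnion (i := 0) (hS hsS)⟩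

theorem norm1_rep_le {k : ℕ} (hk : k + 2 ≤ X.rank) (f : Finset V → Finset V → G) :
    (X.rep k).norm1 f ≤ X.mass (k + 1) (EdgeDefect k f) := by
  classical
  rw [mass_eq_norm]
  refine norm_rep_le hk (Finset.filter_subset _ _) (Finset.filter_subset _ _) fun s hs => ?_
  obtain ⟨hs, u, v, rfl, hne⟩ := Finset.mem_filter.1 hs
  obtain ⟨K, a, b, hK, ha, hb, hab, rfl, rfl, hU⟩ := exists_insert_of_edge hs
  exact Finset.mem_filter.2 ⟨repUnion_mem_dimFaces hs, K, a, b, hK, ha, hb, hab, hU, hne⟩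

/-- The constant with which the empty triangle test tests the coboundaries. -/
noncomputable def testConst (k : ℕ) (γ : ℝ) : ℝ := (potentialConst γ k * 2 ^ (k + 4))⁻¹

theorem testConst_pos (k : ℕ) {γ : ℝ} (hγ : 0 < γ) : 0 < testConst k γ := by
  have := potentialConst_pos hγ k
  unfold testConst
  positivity

/-- The coboundaries of the representation complex are tested by the empty triangle test. -/
theorem testConst_mul_distB1_le [DecidableEq G] (hX : X.IsPure) {γ : ℝ} (hγ : 0 < γ) {k : ℕ}
    (hk : 1 ≤ k) (h : k + 3 ≤ X.rank) (hexp : X.IsCoboundaryExpander G γ)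
    {f : Finset V → Finset V → G} (hf : (X.rep k).IsCochain f) :
    testConst k γ * (X.rep k).distB1 f ≤
      (X.emptyTriangleTest G k hk h).rejectProb ((X.rep k).edgeOracle f) := by
  obtain ⟨p, hp⟩ := exists_potential hX hγ k
    (fun K hK hKc => (hexp K hK (by omega)).2) hf
  have hA := potentialConst_pos hγ k
  rw [testConst, inv_mul_le_iff₀ (by positivity)]
  calc _ ≤ _ := distB1_le f p
    _ ≤ _ := norm1_rep_le (by omega) _
    _ ≤ _ := hp
    _ ≤ _ := mul_le_mul_of_nonneg_left (mass_defects_le_rejectProb hk h hf) hA.le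
    _ = _ := by ring

end EmptyTriangleTest

end FinComplex

namespace FinComplex

/-! ### List assignments: the cover cochain and the list agreement test -/

section ListAgreement

variable {V : Type*} [DecidableEq V] {X : FinComplex V} {k l : ℕ}

theorem Matches.symm {W : Type*} {s t : Finset W} {a : Fin l → ({v // v ∈ s} → Bool)}
    {b : Fin l → ({v // v ∈ t} → Bool)} {π : Equiv.Perm (Fin l)} (h : Matches a b π) :
    Matches b a π⁻¹ := by
  intro i v ht hs
  have := h (π⁻¹ i) v hs ht
  rwa [show π (π⁻¹ i) = i from π.apply_symm_apply i, eq_comm] at this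

/-- Both candidates in the list of t restrict to the same function on the intersection, so they can
differ only at the single vertex of t outside s. Different functions of the list would differ at two
vertices. -/
theorem LAssignment.TwoLocallyDiffering.matches_unique {F : X.LAssignment k l}
    (hF : F.TwoLocallyDiffering) {s t : {s // s ∈ X.dimFaces k}}
    (hst : ({s.1, t.1} : Finset (Finset V)) ∈ (X.rep k).dimFaces 1) {π ρ : Equiv.Perm (Fin l)}
    (hπ : Matches (F s) (F t) π) (hρ : Matches (F s) (F t) ρ) : π = ρ := by
  obtain ⟨K, a, b, hK, ha, hb, hab, es, et, -⟩ := exists_insert_of_edge hst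
  ext i : 1
  by_contra hne
  obtain ⟨x, y, hxy, hx, hy⟩ := hF _ _ hne t
  have key : ∀ z : {v // v ∈ t.1}, F t (π i) z ≠ F t (ρ i) z → z.1 = b := by
    intro z hz
    have hzt : z.1 ∈ insert b K := Finset.ext_iff.1 et z.1 |>.1 z.2
    refine (Finset.mem_insert.1 hzt).resolve_right fun hzK => hz ?_
    have hzs : z.1 ∈ s.1 := by rw [es]; exact Finset.mem_insert_of_mem hzK
    exact (hπ i z.1 hzs z.2).symm.trans (hρ i z.1 hzs z.2)
  exact hxy (Subtype.ext ((key x hx).trans (key y hy).symm))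

theorem coverPerm_matches {W : Type*} {s t : Finset W}
    {a : Fin l → ({v // v ∈ s} → Bool)} {b : Fin l → ({v // v ∈ t} → Bool)} (h : ∃ π, Matches a b π) :
    Matches a b (coverPerm a b) := by
  rw [coverPerm, dif_pos h]
  exact h.choose_spec

/-- The cochain which describes the near cover given by the lists of `F`. -/
noncomputable def coverCochain (F : X.LAssignment k l) (u v : Finset V) : Equiv.Perm (Fin l) :=
  if h : u ∈ X.dimFaces k ∧ v ∈ X.dimFaces k then (coverPerm (F ⟨u, h.1⟩) (F ⟨v, h.2⟩))⁻¹ else 1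

theorem coverCochain_coe (F : X.LAssignment k l) (s t : {s // s ∈ X.dimFaces k}) :
    coverCochain F s.1 t.1 = (coverPerm (F s) (F t))⁻¹ :=
  dif_pos ⟨s.2, t.2⟩

/-- The inverse of a matching permutation matches in the opposite direction, and by uniqueness it is
the one chosen there. If no matching exists, both values are the default 1. -/
theorem isCochain_coverCochain {F : X.LAssignment k l} (hF : F.TwoLocallyDiffering) :
    (X.rep k).IsCochain (coverCochain F) := by
  intro u v huv
  have hu := mem_dimFaces_of_mem_rep huv (a := u) (by simp)
  have hv := mem_dimFaces_of_mem_rep huv (a := v) (by simp)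
  lift u to {s // s ∈ X.dimFaces k} using hu
  lift v to {s // s ∈ X.dimFaces k} using hv
  rw [coverCochain_coe, coverCochain_coe, inv_inv]
  by_cases h : ∃ π, Matches (F u) (F v) π
  · have h1 := coverPerm_matches h
    have h' : ∃ π, Matches (F v) (F u) π := ⟨_, h1.symm⟩
    have h2 := coverPerm_matches h'
    exact hF.matches_unique (by rwa [Finset.pair_comm]) h1.symm h2
  · have h' : ¬ ∃ π, Matches (F v) (F u) π := fun ⟨π, hπ⟩ => h ⟨_, hπ.symm⟩
    rw [coverPerm, coverPerm, dif_neg h, dif_neg h', inv_one]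

theorem matches_of_agreesWith {F : X.LAssignment k l} {g : Fin l → V → Bool}
    {π : {s // s ∈ X.dimFaces k} → Equiv.Perm (Fin l)}
    (h : ∀ i, Assignment.AgreesWith (X := X) (k := k) (fun s => F s (π s i)) (g i))
    (s t : {s // s ∈ X.dimFaces k}) : Matches (F s) (F t) (π t * (π s)⁻¹) := by
  intro i v hs ht
  have h1 := h ((π s)⁻¹ i) s ⟨v, hs⟩
  have h2 := h ((π s)⁻¹ i) t ⟨v, ht⟩
  beta_reduce at h1
  rw [show π s ((π s)⁻¹ i) = i from (π s).apply_symm_apply i] at h1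
  exact h1.trans h2.symm

/-- If π numbers the lists according to global functions, then π t (π s)⁻¹ matches s with t, hence
is the chosen permutation, and its inverse is d₀ π. -/
theorem isCoboundary_coverCochain {F : X.LAssignment k l} (hF : F.TwoLocallyDiffering)
    (h : F.IsAgreeing) : (X.rep k).IsCoboundary (coverCochain F) := by
  classical
  obtain ⟨g, π, h⟩ := h
  refine ⟨fun u => if hu : u ∈ X.dimFaces k then π ⟨u, hu⟩ else 1, fun u v huv => ?_⟩
  have hu := mem_dimFaces_of_mem_rep huv (a := u) (by simp)
  have hv := mem_dimFaces_of_mem_rep huv (a := v) (by simp)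
  lift u to {s // s ∈ X.dimFaces k} using hu
  lift v to {s // s ∈ X.dimFaces k} using hv
  have hm := matches_of_agreesWith h u v
  rw [coverCochain_coe, hF.matches_unique huv (coverPerm_matches ⟨_, hm⟩) hm]
  simp [d0, u.2, v.2]

theorem eval_queryList (F : X.LAssignment k l) (s : {s // s ∈ X.dimFaces k}) :
    (X.queryList k l s).eval F.oracle = F s :=
  QueryTree.eval_askAll _ _

theorem fst_eq_of_mem_asked_queryList {F : X.LAssignment k l} {s : {s // s ∈ X.dimFaces k}}
    {q : X.ListQuery k l} (hq : q ∈ (X.queryList k l s).asked F.oracle) : q.1 = s := by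
  obtain ⟨i, -, rfl⟩ := Finset.mem_image.1 (QueryTree.asked_askAll_subset _ _ hq)
  rfl

theorem eval_queryCoverEdge (F : X.LAssignment k l) (s t : {s // s ∈ X.dimFaces k}) :
    (X.queryCoverEdge k l s t).eval F.oracle = coverCochain F s.1 t.1 := by
  rw [queryCoverEdge, QueryTree.eval_bind, QueryTree.eval_bind, coverCochain_coe,
    eval_queryList, eval_queryList]
  rfl

theorem fst_eq_of_mem_asked_queryCoverEdge {F : X.LAssignment k l}
    {s t : {s // s ∈ X.dimFaces k}} {q : X.ListQuery k l}
    (hq : q ∈ (X.queryCoverEdge k l s t).asked F.oracle) : q.1 = s ∨ q.1 = t := by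
  rw [queryCoverEdge, QueryTree.asked_bind, QueryTree.asked_bind] at hq
  simp only [QueryTree.asked, Finset.union_empty, Finset.mem_union] at hq
  exact hq.imp fst_eq_of_mem_asked_queryList fst_eq_of_mem_asked_queryList

theorem adequateEdgeTree_spec (e : {e // e ∈ (X.rep k).dimFaces 1}) :
    ∃ s t, e.1 = {s.1, t.1} ∧ X.adequateEdgeTree k l e = X.adequateTree k l s t := by
  have h : ∃ p : Finset V × Finset V, e.1 = {p.1, p.2} := by
    obtain ⟨u, v, _, h⟩ := Finset.card_eq_two.1 (Finset.mem_filter.1 e.2).2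
    exact ⟨(u, v), h⟩
  have h1 : h.choose.1 ∈ e.1 :=
    (Finset.ext_iff.1 h.choose_spec _).2 (Finset.mem_insert_self _ _)
  have h2 : h.choose.2 ∈ e.1 :=
    (Finset.ext_iff.1 h.choose_spec _).2
      (Finset.mem_insert_of_mem (Finset.mem_singleton_self _))
  exact ⟨⟨h.choose.1, mem_dimFaces_of_mem_rep e.2 h1⟩,
    ⟨h.choose.2, mem_dimFaces_of_mem_rep e.2 h2⟩, h.choose_spec, rfl⟩

open scoped Classical in
theorem eval_adequateTree (F : X.LAssignment k l) (s t : {s // s ∈ X.dimFaces k}) :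
    (X.adequateTree k l s t).eval F.oracle = decide (∃ π, Matches (F s) (F t) π) := by
  rw [adequateTree, QueryTree.eval_bind, QueryTree.eval_bind, eval_queryList, eval_queryList]
  rfl

theorem fst_eq_of_mem_asked_adequateTree {F : X.LAssignment k l}
    {s t : {s // s ∈ X.dimFaces k}} {q : X.ListQuery k l}
    (hq : q ∈ (X.adequateTree k l s t).asked F.oracle) : q.1 = s ∨ q.1 = t := by
  rw [adequateTree, QueryTree.asked_bind, QueryTree.asked_bind] at hq
  simp only [QueryTree.asked, Finset.union_empty, Finset.mem_union] at hq
  exact hq.imp fst_eq_of_mem_asked_queryList fst_eq_of_mem_asked_queryList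

/-- Repeated queries count once, so only the number of faces involved matters. -/
theorem card_listQuery_le {A : Finset (X.ListQuery k l)} {t : Finset (Finset V)}
    (h : ∀ q ∈ A, q.1.1 ∈ t) : A.card ≤ t.card * l := by
  have hinj : Function.Injective (fun q : X.ListQuery k l => (q.1.1, q.2)) := by
    rintro ⟨⟨s, hs⟩, i⟩ ⟨⟨t, ht⟩, j⟩ h
    simp only [Prod.mk.injEq] at h
    obtain ⟨rfl, rfl⟩ := h
    rfl
  rw [← Finset.card_image_of_injective A hinj]
  calc _ ≤ (t ×ˢ (Finset.univ : Finset (Fin l))).card := by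
        refine Finset.card_le_card fun x hx => ?_
        obtain ⟨q, hq, rfl⟩ := Finset.mem_image.1 hx
        exact Finset.mem_product.2 ⟨h q hq, Finset.mem_univ _⟩
    _ = _ := by simp

/-- The tree which checks the query answers of the test `T` against the near cover of the lists. -/
theorem listAgreementTest_eq (hk : 1 ≤ k) (h : k + 3 ≤ X.rank) :
    ∃ S : (q : (X.rep k).EdgeQuery) →
        QueryTree (X.ListQuery k l) (X.ListAnswer k l) (Equiv.Perm (Fin l)),
      (∀ (F : X.LAssignment k l) q, (S q).eval F.oracle = coverCochain F q.1.1 q.1.2) ∧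
      (∀ (F : X.LAssignment k l) q, ∀ x ∈ (S q).asked F.oracle,
        x.1.1 = q.1.1 ∨ x.1.1 = q.1.2) ∧
      X.listAgreementTest k l hk h = Tester.mix
        (PMF.map (fun T => T.simulate S) (X.emptyTriangleTest (Equiv.Perm (Fin l)) k hk h))
        (PMF.map (X.adequateEdgeTree k l)
          ((X.rep k).sampleFace 1 (X.le_rank_rep k 0 (by omega)))) :=
  ⟨_, fun _ _ => eval_queryCoverEdge _ _ _, fun _ _ _ hx =>
    (fst_eq_of_mem_asked_queryCoverEdge hx).imp (congrArg Subtype.val) (congrArg Subtype.val), rfl⟩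

theorem card_asked_listAgreementTest_le {hk : 1 ≤ k} {h : k + 3 ≤ X.rank} (F : X.LAssignment k l)
    {T : QueryTree (X.ListQuery k l) (X.ListAnswer k l) Bool}
    (hT : T ∈ (X.listAgreementTest k l hk h).support) : (T.asked F.oracle).card ≤ 3 * l := by
  obtain ⟨S, -, hS2, hS3⟩ := listAgreementTest_eq (X := X) (l := l) hk h
  rw [hS3] at hT
  rcases Tester.mem_support_mix.1 hT with hT | hT
  · obtain ⟨T', hT', rfl⟩ := (PMF.mem_support_map_iff _ _ _).1 hT
    obtain ⟨t, ht, he, rfl⟩ := mem_support_emptyTriangleTest hT'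
    -- The three edges of a triangle involve only three faces, which gives 3l entries although six
    -- lists are requested.
    rw [← ht]
    refine card_listQuery_le fun q hq => ?_
    rw [QueryTree.asked_simulate] at hq
    obtain ⟨e, he, hq⟩ := Finset.mem_biUnion.1 hq
    obtain ⟨h1, h2⟩ := mem_of_mem_asked_triangleTree he
    rcases hS2 F e q hq with h | h <;> rwa [h]
  · obtain ⟨e, -, rfl⟩ := (PMF.mem_support_map_iff _ _ _).1 hT
    obtain ⟨s, t, -, h⟩ := adequateEdgeTree_spec (l := l) e
    rw [h]
    calc _ ≤ ({s.1, t.1} : Finset (Finset V)).card * l := card_listQuery_le fun q hq => by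
          rcases fst_eq_of_mem_asked_adequateTree hq with h | h <;> simp [h]
      _ ≤ 3 * l := Nat.mul_le_mul_right _ (Finset.card_le_two.trans (by omega))

open scoped Classical in
-- Simulating the triangle queries is running the triangle test on the cover cochain; the other half
-- contributes the weight of the edges without a matching.
theorem rejectProb_listAgreementTest (hk : 1 ≤ k) (h : k + 3 ≤ X.rank) (F : X.LAssignment k l) :
    (X.listAgreementTest k l hk h).rejectProb F.oracle =
      ((X.emptyTriangleTest (Equiv.Perm (Fin l)) k hk h).rejectProb
          ((X.rep k).edgeOracle (coverCochain F)) +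
        (X.rep k).norm (((X.rep k).dimFaces 1).filter fun e => ∃ s t : {s // s ∈ X.dimFaces k},
          e = {s.1, t.1} ∧ ¬ ∃ π, Matches (F s) (F t) π)) / 2 := by
  obtain ⟨S, hS1, -, hS3⟩ := listAgreementTest_eq (X := X) (l := l) hk h
  rw [hS3, Tester.rejectProb_mix, Tester.rejectProb_map (ι := {e // e ∈ (X.rep k).dimFaces 1})]
  congr 2
  · unfold Tester.rejectProb
    rw [PMF.map_comp]
    congr 3
    funext T
    exact (QueryTree.eval_simulate _ _ _).trans
      (congrArg (fun O => T.eval O) (funext (hS1 F)))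
  · simp_rw [sampleFace_toReal]
    rw [norm, Finset.sum_filter, ← Finset.sum_coe_sort ((X.rep k).dimFaces 1)]
    refine Finset.sum_congr rfl fun e _ => ?_
    obtain ⟨s, t, he, hT⟩ := adequateEdgeTree_spec (l := l) e
    rw [hT, eval_adequateTree]
    refine if_congr ?_ rfl rfl
    rw [decide_eq_false_iff_not]
    refine ⟨fun h => ⟨s, t, he, h⟩, ?_⟩
    -- The existence of a matching does not depend on which of the two orientations the tree has
    -- fixed.
    rintro ⟨s', t', he', h'⟩ ⟨π, hπ⟩
    apply h'
    have hc : ({s'.1, t'.1} : Finset (Finset V)) = {s.1, t.1} := he'.symm.trans he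
    have hne : s'.1 ≠ t'.1 := by
      intro heq
      have h2 := card_of_mem_dimFaces e.2
      rw [he', heq] at h2
      simp at h2
    have h1 : s'.1 ∈ ({s.1, t.1} : Finset (Finset V)) := hc ▸ by simp
    have h2 : t'.1 ∈ ({s.1, t.1} : Finset (Finset V)) := hc ▸ by simp
    simp only [Finset.mem_insert, Finset.mem_singleton, ← Subtype.ext_iff] at h1 h2
    rcases h1 with rfl | rfl <;> rcases h2 with rfl | rfl
    · exact absurd rfl hne
    · exact ⟨π, hπ⟩
    · exact ⟨_, hπ.symm⟩
    · exact absurd rfl hne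

theorem rejectProb_listAgreementTest_eq_zero {hk : 1 ≤ k} {h : k + 3 ≤ X.rank}
    {F : X.LAssignment k l} (hF : F.TwoLocallyDiffering) (hA : F.IsAgreeing) :
    (X.listAgreementTest k l hk h).rejectProb F.oracle = 0 := by
  classical
  rw [rejectProb_listAgreementTest, Tester.rejectProb_eq_zero, Finset.filter_eq_empty_iff.2]
  · simp [norm]
  · obtain ⟨g, π, hg⟩ := hA
    rintro e - ⟨s, t, -, hst⟩
    exact hst ⟨_, matches_of_agreesWith hg s t⟩
  · intro T hT
    obtain ⟨t, ht, he, rfl⟩ := mem_support_emptyTriangleTest hT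
    exact eval_triangleTree_of_isCoboundary (isCoboundary_coverCochain hF hA)

theorem mem_rep_of_mem_powersetCard {r : Finset V} (hr : r ∈ X.dimFaces (k + 1))
    {e : Finset (Finset V)} (he : e ∈ (r.powersetCard (k + 1)).powersetCard 2) :
    e ∈ (X.rep k).dimFaces 1 ∧ repUnion e = r := by
  obtain ⟨h1, h2⟩ := Finset.mem_powersetCard.1 he
  obtain ⟨u, v, huv, rfl⟩ := Finset.card_eq_two.1 h2
  obtain ⟨hu1, hu2⟩ := Finset.mem_powersetCard.1 (h1 (show u ∈ _ by simp))
  obtain ⟨hv1, hv2⟩ := Finset.mem_powersetCard.1 (h1 (show v ∈ _ by simp))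
  obtain ⟨K, a, b, hK, ha, hb, hab, rfl, rfl, rfl⟩ :=
    exists_insert_pair (card_of_mem_dimFaces hr) hu1 hv1 hu2 hv2 huv
  refine ⟨pair_mem_rep hK ha hb hab (Finset.mem_filter.1 hr).1, ?_⟩
  ext x
  simp only [repUnion, Finset.mem_biUnion, Finset.mem_insert, Finset.mem_singleton, id,
    exists_eq_or_imp, exists_eq_left]
  tauto

open scoped Classical in
-- A pair of k-subfaces of r is an edge of the representation complex with union r, and all these
-- edges have the same weight. So the 1-up test is a test on a random edge.
theorem upRejectProb_le (hk : k + 2 ≤ X.rank) (a : X.Assignment k) :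
    a.upRejectProb ≤ (X.rep k).norm (((X.rep k).dimFaces 1).filter
      fun e => ∃ s t : {s // s ∈ X.dimFaces k}, e = {s.1, t.1} ∧ a.Disagree s t) := by
  set S := ((X.rep k).dimFaces 1).filter
      fun e => ∃ s t : {s // s ∈ X.dimFaces k}, e = {s.1, t.1} ∧ a.Disagree s t with hS
  have hSr : ∀ s ∈ S, repUnion s ∈ X.dimFaces (k + 1) := fun s hs =>
    repUnion_mem_dimFaces (i := 0) (Finset.mem_filter.1 hs).1
  have hC : (0 : ℝ) < ((k + (0 + 2)).choose k : ℝ) := by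
    exact_mod_cast Nat.choose_pos (by omega)
  rw [norm, ← Finset.sum_fiberwise_of_maps_to hSr, Assignment.upRejectProb]
  refine Finset.sum_le_sum fun r hr => ?_
  -- A face r with k + 2 elements has k + 2 facets, and the number of pairs of facets equals the
  -- number of possible cores.
  have e1 : ((r.powersetCard (k + 1)).powersetCard 2).card = (k + (0 + 2)).choose k := by
    rw [Finset.card_powersetCard, Finset.card_powersetCard, card_of_mem_dimFaces hr,
      Nat.choose_succ_self_right, Nat.choose_symm_add]
  have e2 : ∀ s ∈ S.filter (fun s => repUnion s = r), (X.rep k).weight s =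
      X.weight r / ((k + (0 + 2)).choose k : ℝ) := by
    intro s hs
    obtain ⟨hsS, hsr⟩ := Finset.mem_filter.1 hs
    rw [eq_div_iff hC.ne', weight_rep hk (Finset.mem_filter.1 hsS).1, hsr]
  rw [Finset.sum_congr rfl e2, Finset.sum_const, nsmul_eq_mul, e1, mul_div_assoc', mul_div_assoc',
    mul_comm]
  refine div_le_div_of_nonneg_right (mul_le_mul_of_nonneg_right ?_ (X.weight_nonneg r)) hC.le
  refine Nat.cast_le.2 (Finset.card_le_card fun e he => ?_)
  obtain ⟨he, hP⟩ := Finset.mem_filter.1 he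
  obtain ⟨h1, h2⟩ := mem_rep_of_mem_powersetCard hr he
  exact Finset.mem_filter.2 ⟨Finset.mem_filter.2 ⟨h1, hP⟩, h2⟩

theorem Assignment.dist_nonneg (a b : X.Assignment k) : 0 ≤ a.dist b :=
  Finset.sum_nonneg fun s _ => by
    split_ifs
    exacts [X.weight_nonneg _, le_rfl]

theorem Assignment.exists_dist_eq_distAgreeing (a : X.Assignment k) :
    ∃ b : X.Assignment k, b.IsAgreeing ∧ a.dist b = a.distAgreeing := by
  have : Nonempty {b : X.Assignment k // b.IsAgreeing} :=
    ⟨⟨fun _ _ => false, fun _ => false, fun _ _ => rfl⟩⟩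
  obtain ⟨b, hb⟩ := Set.Nonempty.csInf_mem
    (Set.range_nonempty fun b : {b : X.Assignment k // b.IsAgreeing} => a.dist b.1)
    (Set.finite_range _)
  exact ⟨b.1, b.2, hb⟩

theorem LAssignment.dist_nonneg (F H : X.LAssignment k l) : 0 ≤ F.dist H :=
  Finset.sum_nonneg fun s _ => mul_nonneg (X.weight_nonneg _) (by positivity)

theorem LAssignment.distAgreeing_nonneg (F : X.LAssignment k l) : 0 ≤ F.distAgreeing :=
  Real.iInf_nonneg fun H => F.dist_nonneg H.1

/-- If the lists are numbered by permutations `h s`, the distance of the `l`-assignment from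
agreeing is at most the average distance of the `l` assignments obtained in this way. -/
theorem LAssignment.distAgreeing_le (F : X.LAssignment k l)
    (h : {s // s ∈ X.dimFaces k} → Equiv.Perm (Fin l)) :
    F.distAgreeing ≤
      (∑ i, Assignment.distAgreeing (X := X) (k := k) fun s => F s (h s i)) / l := by
  classical
  choose b hb hd using fun i : Fin l =>
    Assignment.exists_dist_eq_distAgreeing (X := X) (k := k) fun s => F s (h s i)
  choose g hg using hb
  -- The i-th nearest agreeing assignment is put back at position h s i, so H is agreeing with the
  -- numbering h itself.
  let H : X.LAssignment k l := fun s j => b ((h s)⁻¹ j) s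
  have hH : H.IsAgreeing := ⟨g, h, fun i s v => by
    have : (h s)⁻¹ (h s i) = i := (h s).symm_apply_apply i
    simp only [H, this]
    exact hg i s v⟩
  have h1 : F.distAgreeing ≤ F.dist H :=
    ciInf_le (f := fun H : {H : X.LAssignment k l // H.IsAgreeing} => F.dist H.1)
      ⟨0, by rintro _ ⟨H, rfl⟩; exact F.dist_nonneg H.1⟩ ⟨H, hH⟩
  refine h1.trans (le_of_eq ?_)
  simp_rw [← hd]
  unfold LAssignment.dist Assignment.dist
  rw [Finset.sum_comm, Finset.sum_div]
  refine Finset.sum_congr rfl fun s _ => ?_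
  rw [← Finset.sum_filter, Finset.sum_const, nsmul_eq_mul, mul_comm, ← div_mul_eq_mul_div]
  congr 3
  -- A list position j where F and H differ corresponds to the assignment number (h s)⁻¹ j that is
  -- wrong at s.
  refine Finset.card_bij' (fun j _ => (h s)⁻¹ j) (fun i _ => h s i) ?_ ?_ ?_ ?_
  · intro j hj
    simpa [H] using hj
  · intro i hi
    simpa [H] using hi
  · intro j _
    exact (h s).apply_symm_apply _
  · intro i _
    exact (h s).symm_apply_apply _

open scoped Classical in
/-- If the cochain of the near cover is close to the coboundary of `h`, the assignments obtained by
numbering the lists by `h` pass the agreement test with high probability. -/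
theorem upRejectProb_le_of_coverCochain (hk : k + 2 ≤ X.rank) (F : X.LAssignment k l)
    (h : Finset V → Equiv.Perm (Fin l)) (i : Fin l) :
    Assignment.upRejectProb (X := X) (k := k) (fun s => F s (h s.1 i)) ≤
      (X.rep k).norm (((X.rep k).dimFaces 1).filter fun e => ∃ s t : {s // s ∈ X.dimFaces k},
          e = {s.1, t.1} ∧ ¬ ∃ π, Matches (F s) (F t) π) +
        (X.rep k).norm1 (fun u v => coverCochain F u v * (d0 h u v)⁻¹) := by
  refine (upRejectProb_le hk _).trans ?_
  rw [norm1, norm, norm, norm]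
  refine le_trans (Finset.sum_le_sum_of_subset_of_nonneg ?_ fun _ _ _ => weight_nonneg _ _)
    ((le_add_of_nonneg_right (Finset.sum_nonneg fun _ _ => weight_nonneg _ _)).trans
      (Finset.sum_union_inter).le)
  intro e he
  obtain ⟨he, s, t, rfl, v, hs, ht, hne⟩ := Finset.mem_filter.1 he
  rw [Finset.mem_union, Finset.mem_filter, Finset.mem_filter]
  by_contra hcon
  obtain ⟨c1, c2⟩ := not_or.1 hcon
  have hm : ∃ π, Matches (F s) (F t) π := by
    by_contra hm
    exact c1 ⟨he, s, t, rfl, hm⟩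
  have hc : coverCochain F s.1 t.1 * (d0 h s.1 t.1)⁻¹ = 1 := by
    by_contra hc
    exact c2 ⟨he, _, _, rfl, hc⟩
  -- Since the cochain records the inverse of the matching, equality with d₀ h makes the matching h
  -- t (h s)⁻¹; it sends entry h s i to entry h t i, so the i-th assignment is consistent on this
  -- edge.
  rw [mul_inv_eq_one, coverCochain_coe, d0, inv_eq_iff_eq_inv, mul_inv_rev, inv_inv] at hc
  have := coverPerm_matches hm (h s.1 i) v hs ht
  rw [hc, Equiv.Perm.mul_apply,
    show (h s.1)⁻¹ (h s.1 i) = i from (h s.1).symm_apply_apply i] at this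
  exact hne this

/-- The list agreement test rejects with probability proportional to the distance from agreeing. -/
theorem distAgreeing_le_rejectProb (hX : X.IsPure) {γ β : ℝ} (hγ : 0 < γ) (hk : 1 ≤ k)
    (hr : k + 3 ≤ X.rank) (hexp : X.IsCoboundaryExpander (Equiv.Perm (Fin l)) γ)
    (hβ : X.IsUpAgreementExpander β) {F : X.LAssignment k l} (hF : F.TwoLocallyDiffering) :
    testConst k γ / (2 * testConst k γ + 2) * (β / k) * F.distAgreeing ≤
      (X.listAgreementTest k l hk hr).rejectProb F.oracle := by
  classical
  have hp := testConst_mul_distB1_le hX hγ hk hr hexp (isCochain_coverCochain hF)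
  obtain ⟨h, hh⟩ := exists_norm1_eq_distB1 (X := X.rep k) (coverCochain F)
  have hup := upRejectProb_le_of_coverCochain (by omega) F h
  rw [rejectProb_listAgreementTest]
  rw [← hh] at hp
  set a := (X.rep k).norm (((X.rep k).dimFaces 1).filter fun e =>
    ∃ s t : {s // s ∈ X.dimFaces k}, e = {s.1, t.1} ∧ ¬ ∃ π, Matches (F s) (F t) π)
  set p := (X.emptyTriangleTest (Equiv.Perm (Fin l)) k hk hr).rejectProb
    ((X.rep k).edgeOracle (coverCochain F))
  set n := (X.rep k).norm1 (fun u v => coverCochain F u v * (d0 h u v)⁻¹)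
  have ha : 0 ≤ a := Finset.sum_nonneg fun _ _ => weight_nonneg _ _
  have hn : 0 ≤ n := Finset.sum_nonneg fun _ _ => weight_nonneg _ _
  have hC := testConst_pos k hγ
  set C := testConst k γ
  have hp0 : 0 ≤ p := (mul_nonneg hC.le hn).trans hp
  have hk0 : (0 : ℝ) < k := by exact_mod_cast hk
  have main : (β / k) * F.distAgreeing ≤ a + n := by
    -- β is not assumed nonnegative; for negative β the left side is at most 0.
    rcases lt_or_ge β 0 with hβ0 | hβ0
    · exact (mul_nonpos_of_nonpos_of_nonneg (div_nonpos_of_nonpos_of_nonneg hβ0.le hk0.le)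
        F.distAgreeing_nonneg).trans (by positivity)
    calc _ ≤ (β / k) * ((∑ i, Assignment.distAgreeing (X := X) (k := k)
          fun s => F s (h s.1 i)) / l) :=
        mul_le_mul_of_nonneg_left (F.distAgreeing_le fun s => h s.1) (by positivity)
      _ = (∑ i, (β / k) * Assignment.distAgreeing (X := X) (k := k)
          fun s => F s (h s.1 i)) / l := by rw [← Finset.mul_sum, mul_div_assoc]
      _ ≤ (∑ _i : Fin l, (a + n)) / l := by
        refine div_le_div_of_nonneg_right (Finset.sum_le_sum fun i _ => ?_) (by positivity)
        -- The factor 1 - (k - 1) / k of the agreement test is 1 / k.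
        refine le_trans (le_of_eq ?_) ((hβ k hk (by omega) _).trans (hup i))
        congr 1
        field_simp
        ring
      -- The quotient l / l is kept because it is 0 for l = 0; only l / l ≤ 1 is needed.
      _ = (l / l) * (a + n) := by
        rw [Finset.sum_const, Finset.card_univ, Fintype.card_fin, nsmul_eq_mul, mul_div_right_comm]
      _ ≤ 1 * (a + n) := mul_le_mul_of_nonneg_right (div_self_le_one _) (by positivity)
      _ = a + n := one_mul _
  rw [mul_assoc]
  calc _ ≤ C / (2 * C + 2) * (a + n) := mul_le_mul_of_nonneg_left main (by positivity)
    _ = (C * a + C * n) / (2 * C + 2) := by ring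
    -- From C n ≤ p one gets C (a + n) ≤ C a + p ≤ (C + 1) (a + p), and the test rejects with
    -- probability (p + a) / 2.
    _ ≤ _ := by
      rw [div_le_div_iff₀ (by positivity) two_pos]
      have := mul_nonneg hC.le hp0
      nlinarith

end ListAgreement

end FinComplex

/-! ### The main theorem -/

theorem theorem5p1 :
    ∃ C : ℕ → ℝ → ℝ, (∀ (k : ℕ) (γ : ℝ), 0 < γ → 0 < C k γ) ∧
      ∀ (V : Type*) [DecidableEq V] (X : FinComplex V) (k l : ℕ) (γ β : ℝ)
        (hk : 1 ≤ k) (hd : k + 3 ≤ X.rank),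
        X.IsPure → 0 < γ → X.IsCoboundaryExpander (Equiv.Perm (Fin l)) γ →
        X.IsUpAgreementExpander β →
        -- the empty triangle test with three queries tests the coboundaries, with constant `C`
        (∀ f : Finset V → Finset V → Equiv.Perm (Fin l), (X.rep k).IsCochain f →
          (∀ T ∈ (X.emptyTriangleTest (Equiv.Perm (Fin l)) k hk hd).support,
            (T.asked ((X.rep k).edgeOracle f)).card = 3) ∧
          ((X.rep k).IsCoboundary f →
            (X.emptyTriangleTest (Equiv.Perm (Fin l)) k hk hd).rejectProb
              ((X.rep k).edgeOracle f) = 0) ∧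
          C k γ * (X.rep k).distB1 f ≤
            (X.emptyTriangleTest (Equiv.Perm (Fin l)) k hk hd).rejectProb
              ((X.rep k).edgeOracle f)) ∧
        -- the test for list agreement
        (∀ F : X.LAssignment k l, F.TwoLocallyDiffering →
          (∀ T ∈ (X.listAgreementTest k l hk hd).support, (T.asked F.oracle).card ≤ 3 * l) ∧
          (F.IsAgreeing → (X.listAgreementTest k l hk hd).rejectProb F.oracle = 0) ∧
          C k γ / (2 * C k γ + 2) * (β / k) * F.distAgreeing ≤
            (X.listAgreementTest k l hk hd).rejectProb F.oracle) := by
  refine ⟨FinComplex.testConst, fun k γ hγ => FinComplex.testConst_pos k hγ, ?_⟩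
  intro V _ X k l γ β hk hd hX hγ hexp hβ
  refine ⟨fun f hf => ⟨fun T hT => ?_, fun hcob => ?_, ?_⟩, fun F hF => ⟨fun T hT => ?_, ?_, ?_⟩⟩
  · obtain ⟨t, ht, he, rfl⟩ := FinComplex.mem_support_emptyTriangleTest hT
    exact FinComplex.card_asked_triangleTree _ _ _ _ _
  · refine Tester.rejectProb_eq_zero fun T hT => ?_
    obtain ⟨t, ht, he, rfl⟩ := FinComplex.mem_support_emptyTriangleTest hT
    exact FinComplex.eval_triangleTree_of_isCoboundary hcob
  · exact FinComplex.testConst_mul_distB1_le hX hγ hk hd hexp hf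
  · exact FinComplex.card_asked_listAgreementTest_le F hT
  · exact FinComplex.rejectProb_listAgreementTest_eq_zero hF
  · exact FinComplex.distAgreeing_le_rejectProb hX hγ hk hd hexp hβ hF
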